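/- Let $G$ be a connected reductive linear algebraic group over $\mathbb{C}$ with Lie algebra $\mathfrak{g}$, and let $V$ be a finite-dimensional rational representation of $G$. For $v \in V$ with closed orbit $G\cdot v$, put $\mathfrak{c}_v = \{x \in V : \mathfrak{g}\cdot x \subseteq \mathfrak{g}\cdot v\}$; a subspace $C \subseteq V$ is called a Cartan subspace if $C = \mathfrak{c}_v$ for some such $v$ and $\dim C = \dim V/\!/G$, and the representation is called polar if it has a Cartan subspace. Assume that $V$ is polar with Cartan subspace $C$, and that it is stable, i.e. $\dim C + \dim \mathfrak{g}\cdot C = \dim V$, where $\mathfrak{g}\cdot C$ is the span of all $X\cdot c$ with $X \in \mathfrak{g}$, $c \in C$. Let $Z_G(C) = \{g \in G : g\cdot c = c \text{ for all } c \in C\}$, let $Z_G(C)^0$ be its identity component, and let $I = Z_G(C)/Z_G(C)^0$. Then for every $g \in Z_G(C)$ the determinant of $g$ acting on $V$ satisfies $\det(g) = \pm 1$. Moreover, the determinant character descends to $I$: there is a unique group homomorphism $\tau : I \to \{\pm 1\}$ such that $\tau(g\, Z_G(C)^0) = \det(g)$ for all $g \in Z_G(C)$. -/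

import Mathlib

open Matrix

noncomputable section

namespace PolarRep

/-- The Zariski topology on `GL_n(ℂ)`: the sets `{g | p(g) ≠ 0}`, for `p` a polynomial in the
matrix entries, form a basis of open sets. -/
@[reducible]
def zariski (n : ℕ) : TopologicalSpace (GL (Fin n) ℂ) :=
  TopologicalSpace.generateFrom
    {U | ∃ p : MvPolynomial (Fin n × Fin n) ℂ,
      U = {g : GL (Fin n) ℂ | MvPolynomial.eval (fun ij => g.1 ij.1 ij.2) p ≠ 0}}

theorem zariski_continuous_mul_left {n : ℕ} (a : GL (Fin n) ℂ) :
    @Continuous _ _ (zariski n) (zariski n) (fun g => a * g) := by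
  let := zariski n
  refine continuous_generateFrom_iff.2 ?_
  rintro U ⟨p, rfl⟩
  refine TopologicalSpace.isOpen_generateFrom_of_mem
    ⟨MvPolynomial.bind₁ (fun ij : Fin n × Fin n =>
      ∑ k, MvPolynomial.C (a.1 ij.1 k) * MvPolynomial.X (k, ij.2)) p, ?_⟩
  ext g
  have key : ∀ (x : Fin n × Fin n → ℂ) (f : Fin n × Fin n → MvPolynomial (Fin n × Fin n) ℂ),
      MvPolynomial.eval x (MvPolynomial.bind₁ f p) =
        MvPolynomial.eval (fun i => MvPolynomial.eval x (f i)) p :=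
    fun x f => MvPolynomial.eval₂Hom_bind₁ (RingHom.id ℂ) x f p
  simp only [Set.mem_preimage, Set.mem_ofPred_eq, key]
  simp [Matrix.mul_apply]

theorem zariski_continuous_mul_right {n : ℕ} (a : GL (Fin n) ℂ) :
    @Continuous _ _ (zariski n) (zariski n) (fun g => g * a) := by
  let := zariski n
  refine continuous_generateFrom_iff.2 ?_
  rintro U ⟨p, rfl⟩
  refine TopologicalSpace.isOpen_generateFrom_of_mem
    ⟨MvPolynomial.bind₁ (fun ij : Fin n × Fin n =>
      ∑ k, MvPolynomial.X (ij.1, k) * MvPolynomial.C (a.1 k ij.2)) p, ?_⟩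
  ext g
  have key : ∀ (x : Fin n × Fin n → ℂ) (f : Fin n × Fin n → MvPolynomial (Fin n × Fin n) ℂ),
      MvPolynomial.eval x (MvPolynomial.bind₁ f p) =
        MvPolynomial.eval (fun i => MvPolynomial.eval x (f i)) p :=
    fun x f => MvPolynomial.eval₂Hom_bind₁ (RingHom.id ℂ) x f p
  simp only [Set.mem_preimage, Set.mem_ofPred_eq, key]
  simp [Matrix.mul_apply]

theorem mul_mem_component {n : ℕ} (H : Subgroup (GL (Fin n) ℂ)) {a b c : GL (Fin n) ℂ}
    (ha : a ∈ H) (hb : b ∈ @connectedComponentIn _ (zariski n) H 1)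
    (hc : c ∈ @connectedComponentIn _ (zariski n) H 1)
    (hab : a * b ∈ @connectedComponentIn _ (zariski n) H 1) :
    a * c ∈ @connectedComponentIn _ (zariski n) H 1 := by
  let := zariski n
  rw [connectedComponentIn_eq hab]
  refine (isPreconnected_connectedComponentIn.image (fun g => a * g)
    (zariski_continuous_mul_left a).continuousOn).subset_connectedComponentIn
    ⟨b, hb, rfl⟩ ?_ ⟨c, hc, rfl⟩
  rintro _ ⟨g, hg, rfl⟩
  exact H.mul_mem ha (connectedComponentIn_subset _ _ hg)

/-- The identity component `H⁰` of a subgroup `H` of `GL_n(ℂ)`: the connected component of `1`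
in `H` for the Zariski topology. -/
def identityComponent {n : ℕ} (H : Subgroup (GL (Fin n) ℂ)) : Subgroup H where
  carrier := {h | (h : GL (Fin n) ℂ) ∈ @connectedComponentIn _ (zariski n) H 1}
  one_mem' := @mem_connectedComponentIn _ (zariski n) _ _ H.one_mem
  mul_mem' := by
    intro a b ha hb
    exact mul_mem_component H a.2 (@mem_connectedComponentIn _ (zariski n) _ _ H.one_mem) hb
      (by simpa using ha)
  inv_mem' := by
    intro a ha
    have h1 := @mem_connectedComponentIn _ (zariski n) _ _ H.one_mem
    simpa using mul_mem_component H (H.inv_mem a.2) ha h1 (by simpa using h1)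

instance identityComponent_normal {n : ℕ} (H : Subgroup (GL (Fin n) ℂ)) :
    (identityComponent H).Normal where
  conj_mem := by
    intro h hh g
    let := zariski n
    have hcont : Continuous (fun x : GL (Fin n) ℂ => (g : GL (Fin n) ℂ) * x * (g : GL (Fin n) ℂ)⁻¹) :=
      (zariski_continuous_mul_right _).comp (zariski_continuous_mul_left _)
    refine (isPreconnected_connectedComponentIn.image _
      hcont.continuousOn).subset_connectedComponentIn
      ⟨1, mem_connectedComponentIn H.one_mem, by simp⟩ ?_ ⟨h, hh, by simp⟩
    rintro _ ⟨x, hx, rfl⟩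
    exact H.mul_mem (H.mul_mem g.2 (connectedComponentIn_subset _ _ hx)) (H.inv_mem g.2)

/-- A representation of `G ≤ GL_n(ℂ)` is rational if its matrix coefficients are regular functions
on `G`, i.e. restrictions of functions of the form `p / det ^ k` with `p` a polynomial in the
matrix entries. -/
def IsRational {n : ℕ} {G : Subgroup (GL (Fin n) ℂ)} {V : Type*} [AddCommGroup V] [Module ℂ V]
    (ρ : Representation ℂ G V) : Prop :=
  ∀ (l : Module.Dual ℂ V) (v : V), ∃ (p : MvPolynomial (Fin n × Fin n) ℂ) (k : ℕ), ∀ g : G,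
    l (ρ g v) = MvPolynomial.eval (fun ij => (g : GL (Fin n) ℂ).1 ij.1 ij.2) p /
      (g : GL (Fin n) ℂ).1.det ^ k

/-- A linear algebraic group over `ℂ` is reductive if all its finite-dimensional rational
representations are completely reducible: every invariant subspace has an invariant complement. -/
def IsReductive {n : ℕ} (G : Subgroup (GL (Fin n) ℂ)) : Prop :=
  ∀ (m : ℕ) (ρ : Representation ℂ G (Fin m → ℂ)), IsRational ρ →
    ∀ P : Submodule ℂ (Fin m → ℂ), (∀ g : G, ∀ x ∈ P, ρ g x ∈ P) →
      ∃ Q : Submodule ℂ (Fin m → ℂ), (∀ g : G, ∀ x ∈ Q, ρ g x ∈ Q) ∧ IsCompl P Q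

/-- Connected reductive linear algebraic groups over `ℂ`, realized as Zariski closed subgroups of
`GL_n(ℂ)`. -/
structure IsConnectedReductiveGroup {n : ℕ} (G : Subgroup (GL (Fin n) ℂ)) : Prop where
  isClosed : @IsClosed _ (zariski n) (G : Set (GL (Fin n) ℂ))
  isConnected : @IsConnected _ (zariski n) (G : Set (GL (Fin n) ℂ))
  isReductive : IsReductive G

section Representation

variable {n : ℕ} {G : Subgroup (GL (Fin n) ℂ)} {V : Type*} [AddCommGroup V] [Module ℂ V]

/-- `𝔤 · v`, the span of the vectors `dρ(X) v` for `X ∈ 𝔤 = Lie(G)`.  Here `X ∈ 𝔤` means that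
`exp (t X) ∈ G` for all `t`; the one-parameter subgroup `t ↦ exp (t X)` of `G` is called `γ`, and
`w = dρ(X) v` is the derivative of `ρ (exp (t X)) v` at `t = 0`. -/
def lieOrbit (ρ : Representation ℂ G V) (v : V) : Submodule ℂ V :=
  Submodule.span ℂ {w | ∃ (X : Matrix (Fin n) (Fin n) ℂ) (γ : ℂ → G),
    (∀ t : ℂ, ((γ t : GL (Fin n) ℂ) : Matrix (Fin n) (Fin n) ℂ) = NormedSpace.exp (t • X)) ∧
    ∀ l : Module.Dual ℂ V, HasDerivAt (fun t : ℂ => l (ρ (γ t) v)) (l w) 0}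

variable (V) in
/-- The algebra `ℂ[V]` of polynomial functions on `V`, generated by the linear functions. -/
def polynomialFunctions : Subalgebra ℂ (V → ℂ) :=
  Algebra.adjoin ℂ (Set.range fun l : Module.Dual ℂ V => (l : V → ℂ))

/-- The algebra `ℂ[V]^G` of invariant polynomial functions, the coordinate ring of `V // G`. -/
def invariants (ρ : Representation ℂ G V) : Subalgebra ℂ (V → ℂ) where
  carrier := {f | f ∈ polynomialFunctions V ∧ ∀ (g : G) (x : V), f (ρ g x) = f x}
  mul_mem' := fun ha hb => ⟨mul_mem ha.1 hb.1, fun g x => by simp [ha.2 g x, hb.2 g x]⟩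
  add_mem' := fun ha hb => ⟨add_mem ha.1 hb.1, fun g x => by simp [ha.2 g x, hb.2 g x]⟩
  algebraMap_mem' := fun r => ⟨Subalgebra.algebraMap_mem _ r, fun _ _ => rfl⟩

/-- A vector is semisimple if its orbit is Zariski closed in `V`. -/
def IsSemisimpleVector (ρ : Representation ℂ G V) (v : V) : Prop :=
  ∃ S ⊆ (polynomialFunctions V : Set (V → ℂ)),
    Set.range (fun g : G => ρ g v) = {x | ∀ f ∈ S, f x = 0}

/-- `C` is a Cartan subspace of `V` (in the sense of Dadok and Kac): for some semisimple `v`,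
`C = {x | 𝔤 · x ⊆ 𝔤 · v}` and `dim C = dim V // G`.  The representation is polar if it has a
Cartan subspace. -/
def IsCartanSubspace (ρ : Representation ℂ G V) (C : Submodule ℂ V) : Prop :=
  ∃ v : V, IsSemisimpleVector ρ v ∧ (C : Set V) = {x | lieOrbit ρ x ≤ lieOrbit ρ v} ∧
    (Module.finrank ℂ C : WithBot ℕ∞) = ringKrullDim (invariants ρ)

/-- The stability condition `dim C + dim 𝔤 · C = dim V`. -/
def IsStable (ρ : Representation ℂ G V) (C : Submodule ℂ V) : Prop :=
  Module.finrank ℂ C + Module.finrank ℂ (⨆ c ∈ C, lieOrbit ρ c : Submodule ℂ V) =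
    Module.finrank ℂ V

/-- `Z_G(C)`, the pointwise stabilizer of `C` in `G`, as a subgroup of `GL_n(ℂ)`. -/
def centralizer (ρ : Representation ℂ G V) (C : Submodule ℂ V) : Subgroup (GL (Fin n) ℂ) :=
  Subgroup.map G.subtype
    { carrier := {g : G | ∀ c ∈ C, ρ g c = c}
      one_mem' := fun c _ => by simp
      mul_mem' := fun {a b} ha hb c hc => by
        rw [map_mul, Module.End.mul_apply, hb c hc, ha c hc]
      inv_mem' := fun {a} ha c hc => by
        have h : ρ a⁻¹ (ρ a c) = c := by
          rw [← Module.End.mul_apply, ← map_mul, inv_mul_cancel, map_one, Module.End.one_apply]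
        rwa [ha c hc] at h }

/-- The component group `I = Z_G(C) / Z_G(C)⁰`. -/
abbrev inertia (ρ : Representation ℂ G V) (C : Submodule ℂ V) : Type :=
  centralizer ρ C ⧸ identityComponent (centralizer ρ C)

end Representation

end PolarRep

end

/-
Let `v` be a semisimple vector defining `C`. If `V` carries an inner product for which the image `𝔨`
of `𝔤` in `End V` is stable under adjoints and `𝔨 · v ⟂ v`, then stability gives `V = C ⊕ 𝔨 · v`, so
that `det h = det (h | 𝔨 · v)` for `h ∈ Z_G(C)`. The surjection `X ↦ X v` from `𝔨` onto `𝔨 · v`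
intertwines conjugation by `h` with `h`, and its kernel is the isotropy algebra `𝔨_v`. Both `𝔨` and
`𝔨_v` are stable under adjoints, so the trace form `tr (X Y)` is nondegenerate on each of them;
conjugation by `h` preserves it and hence has determinant `±1` on both, and `det h = ±1` follows.

The inner product comes from two minimizations. Realize `G` as a Zariski closed group of matrices of
determinant one. By reductivity its ring of invariants under right translation is finitely generated
and separates its cosets, so the orbit of a tuple of generators under matrices of determinant one is
closed; a vector of that orbit of minimal norm for the Fischer inner product yields a conjugate of
the matrix group whose Lie algebra is stable under conjugate transposes. Then `v` is replaced by a
vector of minimal norm in its closed orbit, which is orthogonal to its tangent space.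

Finally `det` is a regular function with values in `{1, -1}`, hence constant on the connected group
`Z_G(C)⁰`.
-/

noncomputable section

namespace PolarRep

section Determinants

variable {K V W : Type*} [Field K] [AddCommGroup V] [Module K V] [FiniteDimensional K V]
  [AddCommGroup W] [Module K W]

theorem det_mul_self_eq_one_of_preserves_bilinForm {B : LinearMap.BilinForm K V}
    (hB : B.Nondegenerate) {T : Module.End K V} (hT : ∀ x y, B (T x) (T y) = B x y) :
    LinearMap.det T * LinearMap.det T = 1 := by
  classical
  let b := Module.finBasis K V
  have hcomp : B.comp T T = B := by
    ext x y
    simp [hT]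
  have hdet := congrArg (fun M => Matrix.det (LinearMap.BilinForm.toMatrix b M)) hcomp
  simp only [LinearMap.BilinForm.toMatrix_comp b b, Matrix.det_mul, Matrix.det_transpose,
    LinearMap.det_toMatrix] at hdet
  refine mul_right_cancel₀ ((LinearMap.BilinForm.nondegenerate_iff_det_ne_zero b).1 hB) ?_
  linear_combination hdet

theorem det_eq_det_restrict_ker_mul_det {f : V →ₗ[K] W} (hf : Function.Surjective f)
    {S : Module.End K V} {T : Module.End K W} (hST : f ∘ₗ S = T ∘ₗ f)
    (hker : LinearMap.ker f ≤ (LinearMap.ker f).comap S) :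
    LinearMap.det S = LinearMap.det (S.restrict hker) * LinearMap.det T := by
  let e : (V ⧸ LinearMap.ker f) ≃ₗ[K] W := f.quotKerEquivOfSurjective hf
  rw [LinearMap.det_eq_det_mul_det (LinearMap.ker f) S hker, ← LinearMap.det_conj _ e]
  congr 2
  refine LinearMap.ext fun w => ?_
  obtain ⟨q, rfl⟩ := e.surjective w
  obtain ⟨x, rfl⟩ := Submodule.Quotient.mk_surjective _ q
  simp only [LinearMap.comp_apply, LinearEquiv.coe_coe, LinearEquiv.symm_apply_apply,
    Submodule.mapQ_apply]
  exact LinearMap.congr_fun hST x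

theorem det_eq_det_restrict_of_isCompl {S C : Submodule K V} (hSC : IsCompl S C)
    {T : Module.End K V} (hS : S ≤ S.comap T) (hC : ∀ c ∈ C, T c = c) :
    LinearMap.det T = LinearMap.det (T.restrict hS) := by
  have hquot : S.mapQ S T hS = LinearMap.id := by
    ext x
    obtain ⟨s, hs, c, hc, rfl⟩ := Submodule.mem_sup.1
      (hSC.sup_eq_top ▸ Submodule.mem_top : x ∈ S ⊔ C)
    simp only [LinearMap.comp_apply, Submodule.mkQ_apply, Submodule.mapQ_apply, LinearMap.id_apply,
      map_add, hC c hc]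
    rw [add_left_inj, Submodule.Quotient.eq]
    exact S.sub_mem (hS hs) hs
  rw [LinearMap.det_eq_det_mul_det S T hS, hquot, LinearMap.det_id, mul_one]

end Determinants

section SelfAdjoint

variable {𝕜 V : Type*} [RCLike 𝕜] [NormedAddCommGroup V] [InnerProductSpace 𝕜 V]
  [FiniteDimensional 𝕜 V]

theorem eq_zero_of_trace_mul_adjoint_eq_zero {X : Module.End 𝕜 V}
    (h : LinearMap.trace 𝕜 V (X * LinearMap.adjoint X) = 0) : X = 0 := by
  let b := stdOrthonormalBasis 𝕜 V
  rw [LinearMap.trace_mul_comm, LinearMap.trace_eq_sum_inner _ b] at h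
  have hnorm : ∀ i, inner 𝕜 (b i) ((LinearMap.adjoint X * X) (b i)) =
      ((‖X (b i)‖ ^ 2 : ℝ) : 𝕜) := by
    intro i
    rw [Module.End.mul_apply, LinearMap.adjoint_inner_right, inner_self_eq_norm_sq_to_K]
    norm_cast
  simp_rw [hnorm] at h
  rw [← RCLike.ofReal_sum, RCLike.ofReal_eq_zero,
    Finset.sum_eq_zero_iff_of_nonneg (fun _ _ => by positivity)] at h
  exact b.toBasis.ext fun i => by simpa using h i (Finset.mem_univ i)

/- Conjugation preserves the trace form `tr (X * Y)`, which is nondegenerate on a space of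
endomorphisms closed under adjoints because `tr (X * X†) = 0` only for `X = 0`. -/
theorem det_mul_self_eq_one_of_conj {W : Type*} [AddCommGroup W] [Module 𝕜 W]
    [FiniteDimensional 𝕜 W] {j : W →ₗ[𝕜] Module.End 𝕜 V} (hj : Function.Injective j)
    (hadj : ∀ w, LinearMap.adjoint (j w) ∈ LinearMap.range j) {h : V ≃ₗ[𝕜] V}
    {T : Module.End 𝕜 W} (hT : ∀ w, j (T w) = h.conj (j w)) :
    LinearMap.det T * LinearMap.det T = 1 := by
  let B : LinearMap.BilinForm 𝕜 W :=
    ((LinearMap.mul 𝕜 (Module.End 𝕜 V)).compr₂ (LinearMap.trace 𝕜 V)).compl₁₂ j j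
  have hB : ∀ x y, B x y = LinearMap.trace 𝕜 V (j x * j y) := fun _ _ => rfl
  have hrefl : B.IsRefl := fun x y hxy => by rwa [hB, LinearMap.trace_mul_comm]
  refine det_mul_self_eq_one_of_preserves_bilinForm (B := B)
    (hrefl.nondegenerate_iff_separatingLeft.2 fun x hx => ?_) fun x y => ?_
  · obtain ⟨y, hy⟩ := hadj x
    refine hj (Eq.trans (eq_zero_of_trace_mul_adjoint_eq_zero ?_) (map_zero j).symm)
    rw [← hy]
    exact hx y
  · have hconj : h.conj (j x) * h.conj (j y) = h.conj (j x * j y) := (h.conj_comp _ _).symm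
    rw [hB, hB, hT, hT, hconj, LinearMap.trace_conj']

/- `T` acts with determinant `±1` both on `W` and on the kernel of `f`, hence also on `U`. -/
theorem det_mul_self_eq_one_of_conj_of_surjective {W U : Type*} [AddCommGroup W] [Module 𝕜 W]
    [FiniteDimensional 𝕜 W] [AddCommGroup U] [Module 𝕜 U] {j : W →ₗ[𝕜] Module.End 𝕜 V}
    (hj : Function.Injective j) (hadj : ∀ w, LinearMap.adjoint (j w) ∈ LinearMap.range j)
    {f : W →ₗ[𝕜] U} (hf : Function.Surjective f)
    (hadjker : ∀ w, f w = 0 → ∃ w', f w' = 0 ∧ j w' = LinearMap.adjoint (j w))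
    {h : V ≃ₗ[𝕜] V} {T : Module.End 𝕜 W} (hT : ∀ w, j (T w) = h.conj (j w))
    {T' : Module.End 𝕜 U} (hfT : f ∘ₗ T = T' ∘ₗ f) :
    LinearMap.det T' * LinearMap.det T' = 1 := by
  have hker : LinearMap.ker f ≤ (LinearMap.ker f).comap T := fun w hw => by
    rw [Submodule.mem_comap, LinearMap.mem_ker, ← LinearMap.comp_apply, hfT, LinearMap.comp_apply,
      hw, map_zero]
  have hdetT := det_mul_self_eq_one_of_conj hj hadj hT
  have hdetker : LinearMap.det (T.restrict hker) * LinearMap.det (T.restrict hker) = 1 := by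
    refine det_mul_self_eq_one_of_conj (j := j ∘ₗ (LinearMap.ker f).subtype) (h := h)
      (hj.comp (Submodule.injective_subtype _)) (fun w => ?_) fun w => hT w
    obtain ⟨w', hw', hadj'⟩ := hadjker w w.2
    exact ⟨⟨w', hw'⟩, hadj'⟩
  rwa [det_eq_det_restrict_ker_mul_det hf hfT hker, mul_mul_mul_comm, hdetker, one_mul] at hdetT

variable {𝔨 : Submodule 𝕜 (Module.End 𝕜 V)} {v : V}

theorem adjoint_apply_eq_zero_of_apply_eq_zero (hbr : ∀ X ∈ 𝔨, ∀ Y ∈ 𝔨, ⁅X, Y⁆ ∈ 𝔨)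
    (hadj : ∀ X ∈ 𝔨, LinearMap.adjoint X ∈ 𝔨)
    (hv : ∀ X ∈ 𝔨, inner 𝕜 v (X v) = 0) {X : Module.End 𝕜 V} (hX : X ∈ 𝔨) (hXv : X v = 0) :
    LinearMap.adjoint X v = 0 := by
  have hbr := hv _ (hbr X hX _ (hadj X hX))
  rw [Ring.lie_def, LinearMap.sub_apply, Module.End.mul_apply, Module.End.mul_apply, hXv, map_zero,
    sub_zero, ← LinearMap.adjoint_inner_left] at hbr
  exact inner_self_eq_zero.1 hbr

theorem isCompl_map_applyₗ (hadj : ∀ X ∈ 𝔨, LinearMap.adjoint X ∈ 𝔨)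
    (hv : ∀ X ∈ 𝔨, inner 𝕜 v (X v) = 0) {C : Submodule 𝕜 V}
    (hC : ∀ x ∈ C, ∀ X ∈ 𝔨, X x ∈ 𝔨.map (LinearMap.applyₗ v))
    (hdim : Module.finrank 𝕜 C + Module.finrank 𝕜 (𝔨.map (LinearMap.applyₗ v)) =
      Module.finrank 𝕜 V) : IsCompl (𝔨.map (LinearMap.applyₗ v)) C := by
  have horth : ∀ x ∈ C, ∀ s ∈ 𝔨.map (LinearMap.applyₗ v), inner 𝕜 x s = 0 := by
    rintro x hx _ ⟨X, hX, rfl⟩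
    obtain ⟨Y, hY, hYv⟩ := hC x hx _ (hadj X hX)
    rw [LinearMap.applyₗ_apply_apply] at hYv ⊢
    rw [← LinearMap.adjoint_inner_left, ← hYv, ← inner_conj_symm, hv Y hY, map_zero]
  have hdisj : Disjoint C (𝔨.map (LinearMap.applyₗ v)) :=
    Submodule.disjoint_def.2 fun x hx hs => inner_self_eq_zero.1 (horth x hx x hs)
  exact ⟨hdisj.symm,
    codisjoint_iff.2 (sup_comm C _ ▸ Submodule.eq_top_of_disjoint C _ hdim.ge hdisj)⟩

theorem det_restrict_map_applyₗ_mul_self_eq_one (hbr : ∀ X ∈ 𝔨, ∀ Y ∈ 𝔨, ⁅X, Y⁆ ∈ 𝔨)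
    (hadj : ∀ X ∈ 𝔨, LinearMap.adjoint X ∈ 𝔨)
    (hv : ∀ X ∈ 𝔨, inner 𝕜 v (X v) = 0) {h : V ≃ₗ[𝕜] V} (hh : ∀ X ∈ 𝔨, h.conj X ∈ 𝔨)
    (hhv : h v = v) (hS : 𝔨.map (LinearMap.applyₗ v) ≤
      (𝔨.map (LinearMap.applyₗ v)).comap h.toLinearMap) :
    LinearMap.det (h.toLinearMap.restrict hS) * LinearMap.det (h.toLinearMap.restrict hS) = 1 := by
  let f : 𝔨 →ₗ[𝕜] 𝔨.map (LinearMap.applyₗ v) :=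
    (LinearMap.applyₗ v).restrict fun X hX => ⟨X, hX, rfl⟩
  have hf : ∀ X, (f X : V) = (X : V →ₗ[𝕜] V) v := fun _ => rfl
  have hsurj : Function.Surjective f := by
    rintro ⟨_, X, hX, rfl⟩
    exact ⟨⟨X, hX⟩, rfl⟩
  refine det_mul_self_eq_one_of_conj_of_surjective (j := 𝔨.subtype) (h := h)
    (T := h.conj.toLinearMap.restrict hh)
    (Submodule.injective_subtype 𝔨) (fun X => ⟨⟨_, hadj _ X.2⟩, rfl⟩) hsurj ?_ (fun X => rfl) ?_
  · rintro ⟨X, hX⟩ hXf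
    have hadjv := adjoint_apply_eq_zero_of_apply_eq_zero hbr hadj hv hX (congrArg Subtype.val hXf)
    exact ⟨⟨_, hadj X hX⟩, Subtype.ext hadjv, rfl⟩
  · refine LinearMap.ext fun X => Subtype.ext ?_
    rw [LinearMap.comp_apply, LinearMap.comp_apply, LinearMap.coe_restrict_apply, hf, hf,
      LinearMap.coe_restrict_apply, LinearEquiv.coe_coe, LinearEquiv.conj_apply_apply,
      h.symm_apply_eq.2 hhv.symm, LinearEquiv.coe_coe]

theorem det_eq_one_or_eq_neg_one_of_adjoint_mem (hbr : ∀ X ∈ 𝔨, ∀ Y ∈ 𝔨, ⁅X, Y⁆ ∈ 𝔨)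
    (hadj : ∀ X ∈ 𝔨, LinearMap.adjoint X ∈ 𝔨)
    (hv : ∀ X ∈ 𝔨, inner 𝕜 v (X v) = 0) {C : Submodule 𝕜 V} (hvC : v ∈ C)
    (hC : ∀ x ∈ C, ∀ X ∈ 𝔨, X x ∈ 𝔨.map (LinearMap.applyₗ v))
    (hdim : Module.finrank 𝕜 C + Module.finrank 𝕜 (𝔨.map (LinearMap.applyₗ v)) =
      Module.finrank 𝕜 V)
    {h : V ≃ₗ[𝕜] V} (hh : ∀ X ∈ 𝔨, h.conj X ∈ 𝔨) (hfix : ∀ c ∈ C, h c = c) :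
    LinearMap.det h.toLinearMap = 1 ∨ LinearMap.det h.toLinearMap = -1 := by
  have hS : 𝔨.map (LinearMap.applyₗ v) ≤
      (𝔨.map (LinearMap.applyₗ v)).comap h.toLinearMap := by
    rintro _ ⟨X, hX, rfl⟩
    refine ⟨_, hh X hX, ?_⟩
    simp [LinearEquiv.conj_apply_apply, h.symm_apply_eq.2 (hfix v hvC).symm]
  rw [det_eq_det_restrict_of_isCompl (isCompl_map_applyₗ hadj hv hC hdim) hS hfix]
  exact mul_self_eq_one_iff.1
    (det_restrict_map_applyₗ_mul_self_eq_one hbr hadj hv hh (hfix v hvC) hS)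

end SelfAdjoint

section RegularFunctions

theorem eval_mem_subalgebra {X R κ : Type*} [CommRing R] (S : Subalgebra R (X → R))
    {a : κ → X → R} (ha : ∀ i, a i ∈ S) (p : MvPolynomial κ R) :
    (fun x => MvPolynomial.eval (fun i => a i x) p) ∈ S := by
  induction p using MvPolynomial.induction_on with
  | C c =>
    simp only [MvPolynomial.eval_C]
    exact S.algebraMap_mem c
  | add p q hp hq =>
    simp only [map_add]
    exact add_mem hp hq
  | mul_X p i hp =>
    simp only [map_mul, MvPolynomial.eval_X]
    exact mul_mem hp (ha i)

theorem det_mem_subalgebra {X R κ : Type*} [CommRing R] [Fintype κ] [DecidableEq κ]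
    (S : Subalgebra R (X → R)) {M : X → Matrix κ κ R} (hM : ∀ i j, (fun x => M x i j) ∈ S) :
    (fun x => (M x).det) ∈ S := by
  have := eval_mem_subalgebra S (fun ij : κ × κ => hM ij.1 ij.2) (mvPolynomialX κ κ R).det
  simpa only [eval_det_mvPolynomialX] using! this

variable {n : ℕ} (G : Subgroup (GL (Fin n) ℂ))

/-- The coordinate ring `ℂ[G]`: restrictions to `G` of functions of the form `p / det ^ k`, with
`p` a polynomial in the matrix entries.  By definition, `IsRational ρ` says that the matrix
coefficients of `ρ` belong to it. -/
def regularFunctions : Subalgebra ℂ (G → ℂ) where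
  carrier := {f | ∃ (p : MvPolynomial (Fin n × Fin n) ℂ) (k : ℕ), ∀ g : G,
    f g = MvPolynomial.eval (fun ij => (g : GL (Fin n) ℂ).1 ij.1 ij.2) p /
      (g : GL (Fin n) ℂ).1.det ^ k}
  mul_mem' := by
    rintro f f' ⟨p, k, h⟩ ⟨p', k', h'⟩
    refine ⟨p * p', k + k', fun g => ?_⟩
    rw [Pi.mul_apply, h, h', map_mul, pow_add, div_mul_div_comm]
  add_mem' := by
    rintro f f' ⟨p, k, h⟩ ⟨p', k', h'⟩
    refine ⟨p * (mvPolynomialX (Fin n) (Fin n) ℂ).det ^ k' +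
      (mvPolynomialX (Fin n) (Fin n) ℂ).det ^ k * p', k + k', fun g => ?_⟩
    have hdet := GeneralLinearGroup.det_ne_zero (g : GL (Fin n) ℂ)
    simp only [Pi.add_apply, h, h', map_add, map_mul, map_pow, eval_det_mvPolynomialX]
    rw [pow_add]
    exact div_add_div _ _ (pow_ne_zero _ hdet) (pow_ne_zero _ hdet)
  algebraMap_mem' := fun c => ⟨MvPolynomial.C c, 0, fun g => by simp⟩

variable {G}

theorem entry_mem_regularFunctions (i j : Fin n) :
    (fun g : G => (g : GL (Fin n) ℂ).1 i j) ∈ regularFunctions G :=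
  ⟨MvPolynomial.X (i, j), 0, fun g => by simp⟩

theorem inv_det_mem_regularFunctions :
    (fun g : G => ((g : GL (Fin n) ℂ).1.det)⁻¹) ∈ regularFunctions G :=
  ⟨1, 1, fun g => by simp⟩

theorem entry_inv_mem_regularFunctions (i j : Fin n) :
    (fun g : G => ((g⁻¹ : G) : GL (Fin n) ℂ).1 i j) ∈ regularFunctions G := by
  have cramer (g : G) : ((g⁻¹ : G) : GL (Fin n) ℂ).1 i j = ((g : GL (Fin n) ℂ).1.det)⁻¹ *
      ((g : GL (Fin n) ℂ).1.updateRow j (Pi.single i 1)).det := by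
    rw [InvMemClass.coe_inv, coe_units_inv, inv_def, Ring.inverse_eq_inv', Matrix.smul_apply,
      adjugate_apply, smul_eq_mul]
  simp only [cramer]
  refine mul_mem inv_det_mem_regularFunctions (det_mem_subalgebra _ fun a b => ?_)
  obtain rfl | ha := eq_or_ne a j
  · simp only [updateRow_self]
    exact (regularFunctions G).algebraMap_mem (Pi.single (M := fun _ => ℂ) i 1 b)
  · simp only [updateRow_ne ha]
    exact entry_mem_regularFunctions a b

theorem comp_inv_mem_regularFunctions {f : G → ℂ} (hf : f ∈ regularFunctions G) :
    (fun g => f g⁻¹) ∈ regularFunctions G := by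
  obtain ⟨p, k, h⟩ := hf
  have hinv (g : G) : f g⁻¹ =
      MvPolynomial.eval (fun ij => ((g⁻¹ : G) : GL (Fin n) ℂ).1 ij.1 ij.2) p *
        (g : GL (Fin n) ℂ).1.det ^ k := by
    rw [h, InvMemClass.coe_inv, coe_units_inv, det_nonsing_inv, Ring.inverse_eq_inv', inv_pow,
      div_inv_eq_mul]
  simp only [hinv]
  exact mul_mem
    (eval_mem_subalgebra _ (fun ij : Fin n × Fin n => entry_inv_mem_regularFunctions ij.1 ij.2) p)
    (pow_mem (det_mem_subalgebra _ entry_mem_regularFunctions) k)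

end RegularFunctions

section CompleteReducibility

variable {n : ℕ} {G : Subgroup (GL (Fin n) ℂ)} {W : Type*} [AddCommGroup W] [Module ℂ W]
  {σ : Representation ℂ G W}

theorem IsRational.subrepresentation (hσ : IsRational σ) (P : Submodule ℂ W)
    (hP : ∀ g, P ≤ P.comap (σ g)) : IsRational (σ.subrepresentation P hP) := by
  intro l x
  obtain ⟨L, hL⟩ := l.exists_extend
  obtain ⟨p, k, h⟩ := hσ L x
  exact ⟨p, k, fun g => (LinearMap.congr_fun hL _).symm.trans (h g)⟩

theorem IsRational.finsupp (hσ : IsRational σ) (J : Type*) : IsRational (σ.finsupp J) := by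
  intro l F
  change (fun g => l (σ.finsupp J g F)) ∈ regularFunctions G
  induction F using Finsupp.induction_linear with
  | zero =>
    simp only [map_zero]
    exact zero_mem (regularFunctions G)
  | add F F' hF hF' =>
    simp only [map_add]
    exact add_mem hF hF'
  | single j w =>
    simp only [Representation.finsupp_single]
    exact hσ (l.comp (Finsupp.lsingle j)) w

theorem IsReductive.exists_isCompl [FiniteDimensional ℂ W] (hG : IsReductive G)
    (hσ : IsRational σ) (P : Submodule ℂ W) (hP : ∀ g, ∀ x ∈ P, σ g x ∈ P) :
    ∃ Q : Submodule ℂ W, (∀ g, ∀ x ∈ Q, σ g x ∈ Q) ∧ IsCompl P Q := by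
  let e := (Module.finBasis ℂ W).equivFun
  let σ' : Representation ℂ G (Fin (Module.finrank ℂ W) → ℂ) :=
    (e.conjRingEquiv : Module.End ℂ W →* _).comp σ
  have hσ' (g : G) (x : Fin (Module.finrank ℂ W) → ℂ) : σ' g x = e (σ g (e.symm x)) := rfl
  have hrat : IsRational σ' := fun l x => hσ (l.comp e.toLinearMap) (e.symm x)
  obtain ⟨Q, hQ, hPQ⟩ := hG _ σ' hrat (P.map e.toLinearMap) (by
    rintro g _ ⟨x, hx, rfl⟩
    exact ⟨σ g x, hP g x hx, by simp [hσ']⟩)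
  refine ⟨Q.comap e.toLinearMap, fun g x hx => ?_, ?_⟩
  · simpa [hσ'] using hQ g _ hx
  · rw [← Submodule.comap_map_eq_of_injective (f := e.toLinearMap) e.injective P]
    exact hPQ.map (Submodule.orderIsoMapComap e).symm

theorem IsReductive.exists_fixed_sub_mem [FiniteDimensional ℂ W] (hG : IsReductive G)
    (hσ : IsRational σ) (K : Submodule ℂ W) (hK : ∀ g, ∀ x ∈ K, σ g x ∈ K) (w : W)
    (hw : ∀ g, σ g w - w ∈ K) : ∃ w', (∀ g, σ g w' = w') ∧ w - w' ∈ K := by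
  obtain ⟨Q, hQ, hKQ⟩ := hG.exists_isCompl hσ K hK
  obtain ⟨k, q, hk, hq, rfl⟩ := Submodule.codisjoint_iff_exists_add_eq.1 hKQ.codisjoint w
  refine ⟨q, fun g => ?_, by simpa using hk⟩
  have hmemK : σ g q - q ∈ K := by
    have := K.sub_mem (hw g) (K.sub_mem (hK g k hk) hk)
    rw [map_add] at this
    convert this using 1
    abel
  exact sub_eq_zero.1 (Submodule.disjoint_def.1 hKQ.disjoint _ hmemK (Q.sub_mem (hQ g q hq) hq))

end CompleteReducibility

section MatrixPolynomials

open MvPolynomial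

variable {ι R K : Type*} [CommRing R] [Field K]

/-- Evaluation of a polynomial function on the space of square matrices. -/
def evalMat (x : Matrix ι ι R) : MvPolynomial (ι × ι) R →ₐ[R] R :=
  aeval fun p => x p.1 p.2

@[simp]
theorem evalMat_X (x : Matrix ι ι R) (p : ι × ι) : evalMat x (X p) = x p.1 p.2 :=
  aeval_X _ _

/-- A set of square matrices is Zariski closed if it contains every matrix at which all the
polynomials vanishing on the set vanish. -/
def IsZariskiClosed (S : Set (Matrix ι ι R)) : Prop :=
  ∀ x, (∀ p, (∀ y ∈ S, evalMat y p = 0) → evalMat x p = 0) → x ∈ S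

theorem evalMat_ext [IsDomain R] [Infinite R] {p q : MvPolynomial (ι × ι) R}
    (h : ∀ x, evalMat x p = evalMat x q) : p = q :=
  MvPolynomial.funext fun y => by
    simpa only [evalMat, aeval_eq_eval] using! h (.of fun i j => y (i, j))

theorem evalMat_det [Fintype ι] [DecidableEq ι] (x : Matrix ι ι R) :
    evalMat x (mvPolynomialX ι ι R).det = x.det := by
  rw [evalMat, aeval_eq_eval]
  exact eval_det_mvPolynomialX ι R _

/-- In bounded degree, every linear functional is a combination of evaluations, because no nonzero
polynomial is killed by all of them. -/
theorem exists_dual_eq_finsuppSum_evalMat [Finite ι] [Infinite K]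
    (l : Module.Dual K (MvPolynomial (ι × ι) K)) (D : ℕ) :
    ∃ c : Matrix ι ι K →₀ K, ∀ f : MvPolynomial (ι × ι) K, f.totalDegree ≤ D →
      l f = c.sum fun x a => a * evalMat x f := by
  let W := restrictTotalDegree (ι × ι) K D
  let ev (x : Matrix ι ι K) : Module.Dual K W := (evalMat x).toLinearMap.domRestrict W
  have hspan : Submodule.span K (Set.range ev) = ⊤ := by
    refine Submodule.span_eq_top_of_ne_zero fun f hf => ?_
    by_contra! h
    exact hf (Subtype.ext (evalMat_ext fun x => (h _ ⟨x, rfl⟩).trans (map_zero _).symm))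
  obtain ⟨c, hc⟩ := Finsupp.mem_span_range_iff_exists_finsupp.1
    (hspan ▸ Submodule.mem_top : l.domRestrict W ∈ _)
  refine ⟨c, fun f hf => ?_⟩
  have := LinearMap.congr_fun hc ⟨f, (mem_restrictTotalDegree _ _ _).2 hf⟩
  simpa [Finsupp.sum, ev, LinearMap.sum_apply] using this.symm

variable [Fintype ι]

/-- Right translation of polynomial functions on matrices: `f ↦ (x ↦ f (x * m))`. -/
def rightTranslate (m : Matrix ι ι R) : MvPolynomial (ι × ι) R →ₐ[R] MvPolynomial (ι × ι) R :=
  aeval fun p => ∑ a, X (p.1, a) * C (m a p.2)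

theorem rightTranslate_X (m : Matrix ι ι R) (p : ι × ι) :
    rightTranslate m (X p) = ∑ a, X (p.1, a) * C (m a p.2) :=
  aeval_X _ _

@[simp]
theorem rightTranslate_C (m : Matrix ι ι R) (c : R) :
    rightTranslate m (C c : MvPolynomial (ι × ι) R) = C c :=
  aeval_C _ _

theorem evalMat_rightTranslate (x m : Matrix ι ι R) (f : MvPolynomial (ι × ι) R) :
    evalMat x (rightTranslate m f) = evalMat (x * m) f := by
  have : (evalMat x).comp (rightTranslate m) = evalMat (x * m) := by
    ext p
    simp [rightTranslate_X, mul_apply]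
  exact DFunLike.congr_fun this f

theorem rightTranslate_mul (m m' : Matrix ι ι R) :
    rightTranslate (m * m') = (rightTranslate m).comp (rightTranslate m') := by
  ext1 p
  simp only [AlgHom.comp_apply, rightTranslate_X, map_sum, map_mul, rightTranslate_C, mul_apply,
    Finset.sum_mul, Finset.mul_sum, mul_assoc]
  exact Finset.sum_comm

theorem rightTranslate_one [DecidableEq ι] :
    rightTranslate (1 : Matrix ι ι R) = AlgHom.id R (MvPolynomial (ι × ι) R) := by
  ext1 p
  simp [rightTranslate_X, one_apply, apply_ite (C : R → MvPolynomial (ι × ι) R)]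

theorem rightTranslate_det [DecidableEq ι] (m : Matrix ι ι R) :
    rightTranslate m (mvPolynomialX ι ι R).det = (mvPolynomialX ι ι R).det * C m.det := by
  have h : (rightTranslate m).mapMatrix (mvPolynomialX ι ι R) = mvPolynomialX ι ι R * m.map C := by
    ext1 i j
    simp [rightTranslate_X, mul_apply]
  rw [AlgHom.map_det, h, det_mul, ← RingHom.mapMatrix_apply, ← RingHom.map_det]

theorem isHomogeneous_rightTranslate (m : Matrix ι ι R) {f : MvPolynomial (ι × ι) R} {d : ℕ}
    (hf : f.IsHomogeneous d) : (rightTranslate m f).IsHomogeneous d := by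
  have := hf.aeval (fun p : ι × ι => ∑ a, X (p.1, a) * C (m a p.2)) (n := 1) fun p =>
    IsHomogeneous.sum _ _ _ fun a _ => mul_comm (C (m a p.2)) _ ▸ isHomogeneous_C_mul_X _ _
  rwa [one_mul] at this

theorem homogeneousComponent_rightTranslate (m : Matrix ι ι R) (f : MvPolynomial (ι × ι) R)
    (d : ℕ) :
    homogeneousComponent d (rightTranslate m f) = rightTranslate m (homogeneousComponent d f) := by
  induction f using MvPolynomial.induction_on' with
  | add p q hp hq => simp only [map_add, hp, hq]
  | monomial α c =>
    have hα := isHomogeneous_monomial c (rfl : α.degree = α.degree)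
    rw [homogeneousComponent_of_mem (isHomogeneous_rightTranslate m hα),
      homogeneousComponent_of_mem hα, apply_ite (rightTranslate m), map_zero]

theorem totalDegree_rightTranslate_le (m : Matrix ι ι R) (f : MvPolynomial (ι × ι) R) :
    (rightTranslate m f).totalDegree ≤ f.totalDegree := by
  rw [← sum_homogeneousComponent f, map_sum, sum_homogeneousComponent f]
  refine totalDegree_finsetSum_le fun i hi => ?_
  exact (isHomogeneous_rightTranslate m
    (homogeneousComponent_isHomogeneous i f)).totalDegree_le.trans
    (Nat.lt_succ_iff.1 (Finset.mem_range.1 hi))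

theorem exists_evalMat_eq_evalMat_mul (x : Matrix ι ι R) (f : MvPolynomial (ι × ι) R) :
    ∃ q, ∀ m, evalMat m q = evalMat (x * m) f := by
  refine ⟨aeval (fun p : ι × ι => ∑ a, C (x p.1 a) * X (a, p.2)) f, fun m => ?_⟩
  rw [← AlgHom.comp_apply]
  congr 1
  ext p
  simp [mul_apply]

theorem exists_evalMat_eq_dual_rightTranslate [Infinite K]
    (l : Module.Dual K (MvPolynomial (ι × ι) K)) (f : MvPolynomial (ι × ι) K) :
    ∃ c, ∀ m, evalMat m c = l (rightTranslate m f) := by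
  choose q hq using fun x : Matrix ι ι K => exists_evalMat_eq_evalMat_mul x f
  obtain ⟨c, hc⟩ := exists_dual_eq_finsuppSum_evalMat l f.totalDegree
  refine ⟨c.sum fun x a => a • q x, fun m => ?_⟩
  rw [hc _ (totalDegree_rightTranslate_le m f), map_finsuppSum]
  simp only [map_smul, smul_eq_mul, hq, evalMat_rightTranslate]

theorem dual_rightTranslate_mem_subalgebra [Infinite K] {X : Type*} {S : Subalgebra K (X → K)}
    {M : X → Matrix ι ι K} (hM : ∀ i j, (fun x => M x i j) ∈ S)
    (l : Module.Dual K (MvPolynomial (ι × ι) K)) (f : MvPolynomial (ι × ι) K) :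
    (fun x => l (rightTranslate (M x) f)) ∈ S := by
  obtain ⟨c, hc⟩ := exists_evalMat_eq_dual_rightTranslate l f
  simp only [← hc, evalMat, aeval_eq_eval]
  exact eval_mem_subalgebra S (fun p : ι × ι => hM p.1 p.2) c

end MatrixPolynomials

section LieDerivative

open MvPolynomial

variable {ι R : Type*} [CommRing R] [Fintype ι]

/-- The derivation `f ↦ (x ↦ df(x)(x * A))` of the algebra of polynomial functions on matrices:
the derivative at `m = 1` of right translation by `m` in the direction `A`. -/
def lieDer :
    Matrix ι ι R →ₗ[R] Derivation R (MvPolynomial (ι × ι) R) (MvPolynomial (ι × ι) R) where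
  toFun A := mkDerivation R fun p => ∑ a, A a p.2 • X (p.1, a)
  map_add' A B := derivation_ext fun p => by
    simp [add_smul, Finset.sum_add_distrib]
  map_smul' c A := derivation_ext fun p => by
    simp [mul_smul, Finset.smul_sum]

theorem lieDer_X (A : Matrix ι ι R) (p : ι × ι) :
    lieDer A (X p) = ∑ a, A a p.2 • (X (p.1, a) : MvPolynomial (ι × ι) R) :=
  mkDerivation_X _ _ _

theorem lieDer_lie (A B : Matrix ι ι R) : lieDer ⁅A, B⁆ = ⁅lieDer A, lieDer B⁆ := by
  have h (A B : Matrix ι ι R) (p : ι × ι) : lieDer A (lieDer B (X p)) = lieDer (A * B) (X p) := by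
    simp only [lieDer_X, map_sum, Derivation.map_smul, mul_apply, Finset.sum_smul,
      Finset.smul_sum, smul_smul]
    rw [Finset.sum_comm]
    simp only [mul_comm]
  refine derivation_ext fun p => ?_
  rw [Derivation.commutator_apply, h, h, Ring.lie_def, map_sub, Derivation.sub_apply]

theorem lieDer_rightTranslate {A B m : Matrix ι ι R} (h : A * m = m * B)
    (f : MvPolynomial (ι × ι) R) :
    lieDer A (rightTranslate m f) = rightTranslate m (lieDer B f) := by
  induction f using MvPolynomial.induction_on with
  | C c => simp [← algebraMap_eq]
  | add p q hp hq => simp only [map_add, hp, hq]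
  | mul_X p s hp =>
    have hX : lieDer A (rightTranslate m (X s)) = rightTranslate m (lieDer B (X s)) := by
      have hentry (b : ι) : ∑ a, m a s.2 * A b a = ∑ a, B a s.2 * m b a := by
        simpa only [mul_apply, mul_comm] using congrFun (congrFun h b) s.2
      simp only [lieDer_X, rightTranslate_X, map_sum, mul_comm _ (C _), ← smul_eq_C_mul,
        Derivation.map_smul, map_smul, Finset.smul_sum, smul_smul]
      rw [Finset.sum_comm]
      conv_rhs => rw [Finset.sum_comm]
      simp only [← Finset.sum_smul, hentry]
    simp only [map_mul, Derivation.leibniz, smul_eq_mul, map_add, hp, hX]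

variable {𝕜 : Type*} [NontriviallyNormedField 𝕜]

theorem hasDerivAt_evalMat {A : Matrix ι ι 𝕜} {γ : 𝕜 → Matrix ι ι 𝕜} {t₀ : 𝕜}
    (hγ : ∀ a b, HasDerivAt (fun t => γ t a b) ((γ t₀ * A) a b) t₀) (f : MvPolynomial (ι × ι) 𝕜) :
    HasDerivAt (fun t => evalMat (γ t) f) (evalMat (γ t₀) (lieDer A f)) t₀ := by
  induction f using MvPolynomial.induction_on with
  | C c => simpa [← algebraMap_eq] using hasDerivAt_const t₀ c
  | add p q hp hq =>
    simp only [map_add]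
    exact hp.add hq
  | mul_X p s hp =>
    have hX : evalMat (γ t₀) (lieDer A (X s)) = (γ t₀ * A) s.1 s.2 := by
      simp [lieDer_X, mul_apply, mul_comm]
    simp only [map_mul, evalMat_X, Derivation.leibniz, smul_eq_mul, map_add, hX]
    rw [add_comm, mul_comm (γ t₀ _ _)]
    exact hp.mul (hγ s.1 s.2)

theorem hasDerivAt_dual_rightTranslate {A : Matrix ι ι 𝕜} {γ : 𝕜 → Matrix ι ι 𝕜} {t₀ : 𝕜}
    (hγ : ∀ a b, HasDerivAt (fun t => γ t a b) ((γ t₀ * A) a b) t₀)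
    (l : Module.Dual 𝕜 (MvPolynomial (ι × ι) 𝕜)) (f : MvPolynomial (ι × ι) 𝕜) :
    HasDerivAt (fun t => l (rightTranslate (γ t) f))
      (l (rightTranslate (γ t₀) (lieDer A f))) t₀ := by
  obtain ⟨c, hc⟩ := exists_dual_eq_finsuppSum_evalMat l (max f.totalDegree (lieDer A f).totalDegree)
  have hcf (m : Matrix ι ι 𝕜) :=
    hc _ ((totalDegree_rightTranslate_le m f).trans (le_max_left _ _))
  simp only [hcf, hc _ ((totalDegree_rightTranslate_le (γ t₀) _).trans (le_max_right _ _)),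
    evalMat_rightTranslate]
  refine HasDerivAt.fun_sum fun x _ => (hasDerivAt_evalMat (γ := fun t => x * γ t) ?_ f).const_mul _
  intro a b
  simp only [Matrix.mul_assoc x, Matrix.mul_apply (M := x)]
  exact HasDerivAt.fun_sum fun i _ => (hγ i b).const_mul _

theorem exists_lieDer_det_eq_smul [DecidableEq ι] (A : Matrix ι ι 𝕜) :
    ∃ c : 𝕜, lieDer A (mvPolynomialX ι ι 𝕜).det = c • (mvPolynomialX ι ι 𝕜).det := by
  refine ⟨evalMat 1 (lieDer A (mvPolynomialX ι ι 𝕜).det), evalMat_ext fun x => ?_⟩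
  have hγ (y : Matrix ι ι 𝕜) : HasDerivAt (fun t : 𝕜 => evalMat (y * (1 + t • A))
      (mvPolynomialX ι ι 𝕜).det) (evalMat y (lieDer A (mvPolynomialX ι ι 𝕜).det)) 0 := by
    have := hasDerivAt_evalMat (A := A) (γ := fun t => y * (1 + t • A)) (t₀ := 0) (fun a b => by
      simpa [mul_add] using ((hasDerivAt_id (0 : 𝕜)).mul_const ((y * A) a b)).const_add (y a b))
      (mvPolynomialX ι ι 𝕜).det
    simpa using this
  have h1 := hγ 1
  have hx := hγ x
  simp only [evalMat_det, det_mul, one_mul] at h1 hx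
  simpa [evalMat_det, mul_comm] using hx.unique (h1.const_mul x.det)

end LieDerivative

section Invariants

open MvPolynomial

theorem IsReductive.exists_fixed_sub_mem_of_mem {n : ℕ} {G : Subgroup (GL (Fin n) ℂ)} {W : Type*}
    [AddCommGroup W] [Module ℂ W] {σ : Representation ℂ G W} (hG : IsReductive G)
    (hσ : IsRational σ) (P : Submodule ℂ W) [FiniteDimensional ℂ P] (hP : ∀ g, P ≤ P.comap (σ g))
    (K : Submodule ℂ W) (hK : ∀ g, ∀ x ∈ K, σ g x ∈ K) {w : W} (hwP : w ∈ P)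
    (hw : ∀ g, σ g w - w ∈ K) : ∃ w', (∀ g, σ g w' = w') ∧ w - w' ∈ K := by
  obtain ⟨w', hfix, hsub⟩ := hG.exists_fixed_sub_mem (hσ.subrepresentation P hP)
    (K.comap P.subtype) (fun g x hx => hK g x hx) ⟨w, hwP⟩ hw
  exact ⟨w', fun g => congrArg Subtype.val (hfix g), hsub⟩

variable {ι M R : Type*} [Fintype ι] [DecidableEq ι] [Monoid M] [CommRing R]

/-- The representation of `M` on polynomial functions on matrices given by right translation
through `r`. -/
def rightTranslateRep (r : M →* Matrix ι ι R) : Representation R M (MvPolynomial (ι × ι) R) where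
  toFun g := (rightTranslate (r g)).toLinearMap
  map_one' := by rw [map_one, rightTranslate_one]; rfl
  map_mul' g h := by rw [map_mul, rightTranslate_mul]; rfl

theorem rightTranslateRep_apply (r : M →* Matrix ι ι R) (g : M) (f : MvPolynomial (ι × ι) R) :
    rightTranslateRep r g f = rightTranslate (r g) f :=
  rfl

/-- The algebra of polynomial functions on matrices invariant under right translation by the image
of `r`. -/
def matInvariants (r : M →* Matrix ι ι R) : Subalgebra R (MvPolynomial (ι × ι) R) where
  carrier := {f | ∀ g, rightTranslate (r g) f = f}
  mul_mem' ha hb g := by rw [map_mul, ha g, hb g]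
  add_mem' ha hb g := by rw [map_add, ha g, hb g]
  algebraMap_mem' c g := rightTranslate_C _ c

theorem homogeneousComponent_mem_matInvariants {r : M →* Matrix ι ι R} {f : MvPolynomial (ι × ι) R}
    (hf : f ∈ matInvariants r) (d : ℕ) : homogeneousComponent d f ∈ matInvariants r := fun g => by
  rw [← homogeneousComponent_rightTranslate, hf g]

theorem det_mem_matInvariants {r : M →* Matrix ι ι R} (hdet : ∀ g, (r g).det = 1) :
    (mvPolynomialX ι ι R).det ∈ matInvariants r := fun g => by
  rw [rightTranslate_det, hdet, C_1, mul_one]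

variable {n : ℕ} {G : Subgroup (GL (Fin n) ℂ)} {r : G →* Matrix ι ι ℂ}

theorem isRational_rightTranslateRep (hr : ∀ i j, (fun g => r g i j) ∈ regularFunctions G) :
    IsRational (rightTranslateRep r) :=
  fun l f => dual_rightTranslate_mem_subalgebra hr l f

theorem exists_matInvariants_sub_mem (hG : IsReductive G)
    (hr : ∀ i j, (fun g => r g i j) ∈ regularFunctions G)
    (K : Submodule ℂ (MvPolynomial (ι × ι) ℂ)) (hK : ∀ g, ∀ f ∈ K, rightTranslate (r g) f ∈ K)
    {f : MvPolynomial (ι × ι) ℂ} (hf : ∀ g, rightTranslate (r g) f - f ∈ K) :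
    ∃ f' ∈ matInvariants r, f - f' ∈ K :=
  hG.exists_fixed_sub_mem_of_mem (isRational_rightTranslateRep hr)
    (restrictTotalDegree (ι × ι) ℂ f.totalDegree)
    (fun _ _ hp => (mem_restrictTotalDegree _ _ _).2 <|
      (totalDegree_rightTranslate_le _ _).trans ((mem_restrictTotalDegree _ _ _).1 hp))
    K hK ((mem_restrictTotalDegree _ _ _).2 le_rfl) hf

theorem finsupp_rightTranslateRep_apply {J : Type*} (r : M →* Matrix ι ι R) (g : M)
    (F : J →₀ MvPolynomial (ι × ι) R) (j : J) :
    (rightTranslateRep r).finsupp J g F j = rightTranslate (r g) (F j) := by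
  induction F using Finsupp.induction_linear with
  | zero => simp
  | add F F' hF hF' => simp only [map_add, Finsupp.add_apply, hF, hF']
  | single k f =>
    classical
    simp only [Representation.finsupp_single, rightTranslateRep_apply, Finsupp.single_apply,
      apply_ite (rightTranslate (r g)), map_zero]

theorem exists_matInvariants_family_sub_mem (hG : IsReductive G)
    (hr : ∀ i j, (fun g => r g i j) ∈ regularFunctions G) {J : Type*} [Finite J]
    (K : Submodule ℂ (J →₀ MvPolynomial (ι × ι) ℂ))
    (hK : ∀ g, ∀ F ∈ K, (rightTranslateRep r).finsupp J g F ∈ K)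
    {F : J →₀ MvPolynomial (ι × ι) ℂ}
    (hF : ∀ g, (rightTranslateRep r).finsupp J g F - F ∈ K) :
    ∃ F' : J →₀ MvPolynomial (ι × ι) ℂ, (∀ j, F' j ∈ matInvariants r) ∧ F - F' ∈ K := by
  let D := F.support.sup fun j => (F j).totalDegree
  let P := Finsupp.submodule fun _ : J => restrictTotalDegree (ι × ι) ℂ D
  have mem_P (F' : J →₀ MvPolynomial (ι × ι) ℂ) : F' ∈ P ↔ ∀ j, (F' j).totalDegree ≤ D := by
    simp only [P, Finsupp.mem_submodule_iff, mem_restrictTotalDegree]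
  have totalDegree_le (j : J) : (F j).totalDegree ≤ D := by
    obtain hj | hj := eq_or_ne (F j) 0
    · simp [hj]
    · exact Finset.le_sup (f := fun j => (F j).totalDegree) (Finsupp.mem_support_iff.2 hj)
  have : FiniteDimensional ℂ P := by
    rw [← Submodule.fg_iff_finiteDimensional]
    simp only [P, Finsupp.submodule_eq_iSup]
    exact Submodule.fg_iSup _ fun j => (Submodule.fg_iff_finiteDimensional _).2 inferInstance
  obtain ⟨F', hfix, hsub⟩ := hG.exists_fixed_sub_mem_of_mem
    ((isRational_rightTranslateRep hr).finsupp J) P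
    (fun g F' hF' => (mem_P _).2 fun j => by
      rw [finsupp_rightTranslateRep_apply]
      exact (totalDegree_rightTranslate_le _ _).trans ((mem_P _).1 hF' j))
    K hK ((mem_P F).2 totalDegree_le) hF
  refine ⟨F', fun j g => ?_, hsub⟩
  rw [← finsupp_rightTranslateRep_apply, hfix g]

theorem exists_matInvariants_coeff (hG : IsReductive G)
    (hr : ∀ i j, (fun g => r g i j) ∈ regularFunctions G) {J : Type*} [Finite J]
    {f : J → MvPolynomial (ι × ι) ℂ} (hf : ∀ j, f j ∈ matInvariants r)
    {h : MvPolynomial (ι × ι) ℂ} (hh : h ∈ matInvariants r) (hspan : h ∈ Ideal.span (Set.range f)) :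
    ∃ a : J →₀ MvPolynomial (ι × ι) ℂ, (∀ j, a j ∈ matInvariants r) ∧
      Finsupp.linearCombination _ f a = h := by
  obtain ⟨a, rfl⟩ := Finsupp.mem_span_range_iff_exists_finsupp.1 hspan
  let φ := (Finsupp.linearCombination (MvPolynomial (ι × ι) ℂ) f).restrictScalars ℂ
  have hφ (g : G) (b : J →₀ MvPolynomial (ι × ι) ℂ) :
      φ ((rightTranslateRep r).finsupp J g b) = rightTranslate (r g) (φ b) := by
    induction b using Finsupp.induction_linear with
    | zero => simp only [map_zero]
    | add b b' hb hb' => simp only [map_add, hb, hb']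
    | single j p =>
      simp only [φ, Representation.finsupp_single, LinearMap.restrictScalars_apply,
        Finsupp.linearCombination_single, smul_eq_mul, map_mul, hf j g, rightTranslateRep_apply]
  obtain ⟨a', ha', hsub⟩ := exists_matInvariants_family_sub_mem hG hr (LinearMap.ker φ)
    (fun g b hb => by rw [LinearMap.mem_ker] at hb ⊢; rw [hφ, hb, map_zero]) (F := a)
    (fun g => by rw [LinearMap.mem_ker, map_sub, hφ, sub_eq_zero]; exact hh g)
  refine ⟨a', ha', ?_⟩
  rw [LinearMap.mem_ker, map_sub, sub_eq_zero] at hsub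
  exact hsub.symm

end Invariants

section Hilbert

open MvPolynomial

theorem homogeneousComponent_mul_of_isHomogeneous {σ R : Type*} [CommSemiring R]
    (a : MvPolynomial σ R) {f : MvPolynomial σ R} {e : ℕ} (hf : f.IsHomogeneous e) (d : ℕ) :
    homogeneousComponent d (a * f) = if e ≤ d then homogeneousComponent (d - e) a * f else 0 := by
  let _ := gradedAlgebra (σ := σ) (R := R)
  have hdec (p : MvPolynomial σ R) (i : ℕ) :
      (DirectSum.decompose (homogeneousSubmodule σ R) p i : MvPolynomial σ R) =
        homogeneousComponent i p := decomposition.decompose'_apply p i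
  rw [← hdec, ← hdec]
  exact DirectSum.coe_decompose_mul_of_right_mem (homogeneousSubmodule σ R) d hf

/-- Algebra generators are found among the ideal generators by induction on the degree. -/
theorem subalgebra_fg_of_homogeneousComponent_mem {σ R : Type*} [Finite σ] [CommRing R]
    [IsNoetherianRing R] {A : Subalgebra R (MvPolynomial σ R)}
    (hA : ∀ f ∈ A, ∀ d, homogeneousComponent d f ∈ A)
    (hcoeff : ∀ T : Finset (MvPolynomial σ R), (∀ t : T, t.1 ∈ A) → ∀ h ∈ A,
      h ∈ Ideal.span (T : Set (MvPolynomial σ R)) → ∃ a : T →₀ MvPolynomial σ R,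
        (∀ t, a t ∈ A) ∧ Finsupp.linearCombination _ Subtype.val a = h) : A.FG := by
  let S : Set (MvPolynomial σ R) := {f | f ∈ A ∧ ∃ d, 0 < d ∧ f.IsHomogeneous d}
  obtain ⟨T, hTS, hT⟩ := (Submodule.fg_span_iff_fg_span_finset_subset S).1
    (IsNoetherian.noetherian (Submodule.span (MvPolynomial σ R) S))
  refine ⟨T, le_antisymm (Algebra.adjoin_le fun f hf => (hTS hf).1) ?_⟩
  have homogeneous_mem (d : ℕ) : ∀ h ∈ A, h.IsHomogeneous d →
      h ∈ Algebra.adjoin R (T : Set (MvPolynomial σ R)) := by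
    induction d using Nat.strong_induction_on with
    | _ d ih =>
      intro h hh hhd
      rcases Nat.eq_zero_or_pos d with rfl | hd
      · rw [← homogeneousComponent_eq_self hhd, homogeneousComponent_zero]
        exact Subalgebra.algebraMap_mem _ _
      · obtain ⟨a, ha, rfl⟩ := hcoeff T (fun t => (hTS t.2).1) h hh
          (hT.le (Submodule.subset_span ⟨hh, d, hd, hhd⟩))
        rw [← homogeneousComponent_eq_self hhd, Finsupp.linearCombination_apply, map_finsuppSum]
        refine sum_mem fun t _ => ?_
        obtain ⟨e, he, hte⟩ := (hTS t.2).2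
        beta_reduce
        rw [smul_eq_mul, homogeneousComponent_mul_of_isHomogeneous _ hte]
        split_ifs
        · exact mul_mem (ih _ (by omega) _ (hA _ (ha t) _)
            (homogeneousComponent_isHomogeneous _ _)) (Algebra.subset_adjoin t.2)
        · exact zero_mem _
  intro h hh
  rw [← sum_homogeneousComponent h]
  exact sum_mem fun i _ => homogeneous_mem i _ (hA h hh i) (homogeneousComponent_isHomogeneous i h)

theorem ideal_eq_top_of_forall_exists_evalMat_ne_zero {ι K : Type*} [Finite ι] [Field K]
    [IsAlgClosed K] (I : Ideal (MvPolynomial (ι × ι) K))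
    (h : ∀ x : Matrix ι ι K, ∃ f ∈ I, evalMat x f ≠ 0) : I = ⊤ := by
  by_contra hI
  obtain ⟨M, hM, hIM⟩ := Ideal.exists_le_maximal I hI
  obtain ⟨y, hy⟩ := eq_vanishingIdeal_singleton_of_isMaximal K hM
  obtain ⟨f, hf, hne⟩ := h (Matrix.of fun i j => y (i, j))
  have := hIM hf
  rw [hy, mem_vanishingIdeal_singleton_iff] at this
  exact hne this

variable {n : ℕ} {G : Subgroup (GL (Fin n) ℂ)} {ι : Type*} [Fintype ι] [DecidableEq ι]
  {r : G →* Matrix ι ι ℂ}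

theorem fg_matInvariants (hG : IsReductive G)
    (hr : ∀ i j, (fun g => r g i j) ∈ regularFunctions G) : (matInvariants r).FG :=
  subalgebra_fg_of_homogeneousComponent_mem
    (fun _ hf d => homogeneousComponent_mem_matInvariants hf d)
    fun T hT _ hh hspan => exists_matInvariants_coeff hG hr hT hh (by
      rwa [Subtype.range_coe_subtype])

/-- The polynomials `det - 1` and `f j - y j` have no common zero, so they generate the unit
ideal. -/
theorem exists_matInvariants_sum_mul_sub_eq_one (hG : IsReductive G)
    (hr : ∀ i j, (fun g => r g i j) ∈ regularFunctions G) (hdet : ∀ g, (r g).det = 1)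
    {J : Type*} [Fintype J] {f : J → MvPolynomial (ι × ι) ℂ} (hf : ∀ j, f j ∈ matInvariants r)
    {y : J → ℂ} (hy : ∀ m : Matrix ι ι ℂ, m.det = 1 → ∃ j, evalMat m (f j) ≠ y j) :
    ∃ a : J → MvPolynomial (ι × ι) ℂ, (∀ j, a j ∈ matInvariants r) ∧
      ∀ m : Matrix ι ι ℂ, m.det = 1 → ∑ j, evalMat m (a j) * (evalMat m (f j) - y j) = 1 := by
  let F : Option J → MvPolynomial (ι × ι) ℂ := fun o =>
    o.elim ((mvPolynomialX ι ι ℂ).det - 1) fun j => f j - C (y j)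
  have hF : ∀ o, F o ∈ matInvariants r := by
    rintro (_ | j)
    · exact sub_mem (det_mem_matInvariants hdet) (one_mem _)
    · exact sub_mem (hf j) (Subalgebra.algebraMap_mem _ (y j))
  have htop : Ideal.span (Set.range F) = ⊤ := by
    refine ideal_eq_top_of_forall_exists_evalMat_ne_zero _ fun x => ?_
    by_contra! hx
    have hFx (o : Option J) : evalMat x (F o) = 0 := hx _ (Ideal.subset_span ⟨o, rfl⟩)
    obtain ⟨j, hj⟩ := hy x (by simpa [F, evalMat_det, sub_eq_zero] using hFx none)
    exact hj (by simpa [F, sub_eq_zero] using hFx (some j))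
  obtain ⟨a, ha, hsum⟩ := exists_matInvariants_coeff hG hr hF (one_mem (matInvariants r))
    (htop ▸ Submodule.mem_top)
  refine ⟨fun j => a (some j), fun j => ha (some j), fun m hm => ?_⟩
  have := congrArg (evalMat m) hsum
  simpa [Finsupp.linearCombination_apply, Finsupp.sum_fintype, Fintype.sum_option, F, evalMat_det,
    hm] using this

theorem isClosed_image_evalMat (hG : IsReductive G)
    (hr : ∀ i j, (fun g => r g i j) ∈ regularFunctions G) (hdet : ∀ g, (r g).det = 1)
    {J : Type*} [Finite J] {f : J → MvPolynomial (ι × ι) ℂ}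
    (hf : Algebra.adjoin ℂ (Set.range f) = matInvariants r) :
    IsClosed ((fun (m : Matrix ι ι ℂ) j => evalMat m (f j)) '' {m | m.det = 1}) := by
  have := Fintype.ofFinite J
  refine isClosed_of_closure_subset fun y hy => ?_
  by_contra! hne
  obtain ⟨a, ha, hsum⟩ := exists_matInvariants_sum_mul_sub_eq_one hG hr hdet (y := y)
    (fun j => hf.le (Algebra.subset_adjoin ⟨j, rfl⟩)) fun m hm => by
      by_contra! h
      exact hne ⟨m, hm, funext h⟩
  have hP (j : J) : ∃ P : MvPolynomial J ℂ, aeval f P = a j := by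
    have := ha j
    rwa [← hf, Algebra.adjoin_range_eq_range_aeval] at this
  choose P hP using hP
  have hclosed : IsClosed {z : J → ℂ | ∑ j, eval z (P j) * (z j - y j) = 1} :=
    isClosed_eq (continuous_finsetSum _ fun j _ => ((P j).continuous_eval).mul
      ((continuous_apply j).sub continuous_const)) continuous_const
  have hsub : (fun (m : Matrix ι ι ℂ) j => evalMat m (f j)) '' {m | m.det = 1} ⊆
      {z : J → ℂ | ∑ j, eval z (P j) * (z j - y j) = 1} := by
    rintro _ ⟨m, hm, rfl⟩
    refine (Finset.sum_congr rfl fun j _ => ?_).trans (hsum m hm)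
    rw [← hP, ← AlgHom.comp_apply, comp_aeval, aeval_eq_eval]
  simpa using hclosed.closure_subset_iff.2 hsub hy

theorem exists_matInvariants_of_sup_eq_top (hG : IsReductive G)
    (hr : ∀ i j, (fun g => r g i j) ∈ regularFunctions G) {I I' : Ideal (MvPolynomial (ι × ι) ℂ)}
    (hI : ∀ g, ∀ f ∈ I, rightTranslate (r g) f ∈ I)
    (hI' : ∀ g, ∀ f ∈ I', rightTranslate (r g) f ∈ I') (hsup : I ⊔ I' = ⊤) :
    ∃ f ∈ matInvariants r, f ∈ I ∧ 1 - f ∈ I' := by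
  obtain ⟨a, ha, b, hb, hab⟩ := Submodule.mem_sup.1 ((Ideal.eq_top_iff_one _).1 hsup)
  obtain rfl : b = 1 - a := eq_sub_of_add_eq' hab
  obtain ⟨f, hf, hfI, hfI'⟩ := exists_matInvariants_sub_mem hG hr (f := a)
    ((I ⊓ I').restrictScalars ℂ) (fun g f hf => ⟨hI g f hf.1, hI' g f hf.2⟩) fun g =>
      ⟨sub_mem (hI g a ha) ha, by simpa using sub_mem hb (hI' g _ hb)⟩
  exact ⟨f, hf, by simpa using sub_mem ha hfI, by simpa using add_mem hb hfI'⟩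

/-- The ideal of polynomial functions vanishing on the coset `u * r(G)`. -/
def cosetIdeal (r : G →* Matrix ι ι ℂ) (u : Matrix ι ι ℂ) : Ideal (MvPolynomial (ι × ι) ℂ) :=
  ⨅ g, RingHom.ker (evalMat (u * r g))

theorem mem_cosetIdeal {u : Matrix ι ι ℂ} {f : MvPolynomial (ι × ι) ℂ} :
    f ∈ cosetIdeal r u ↔ ∀ g, evalMat (u * r g) f = 0 := by
  simp only [cosetIdeal, Submodule.mem_iInf, RingHom.mem_ker]

theorem rightTranslate_mem_cosetIdeal {u : Matrix ι ι ℂ} (g : G) (f : MvPolynomial (ι × ι) ℂ)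
    (hf : f ∈ cosetIdeal r u) : rightTranslate (r g) f ∈ cosetIdeal r u :=
  mem_cosetIdeal.2 fun g' => by
    rw [evalMat_rightTranslate, mul_assoc, ← map_mul]
    exact mem_cosetIdeal.1 hf _

theorem cosetIdeal_one_sup_eq_top (hclosed : IsZariskiClosed (Set.range r)) {m : Matrix ι ι ℂ}
    (hdet : m.det = 1) (hm : m ∉ Set.range r) :
    cosetIdeal r 1 ⊔ cosetIdeal r m = ⊤ := by
  have hunit : IsUnit m.det := hdet ▸ isUnit_one
  refine ideal_eq_top_of_forall_exists_evalMat_ne_zero _ fun x => ?_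
  by_contra! hx
  obtain ⟨g, rfl⟩ := hclosed x fun p hp => by
    refine hx p (Ideal.mem_sup_left (mem_cosetIdeal.2 fun g => ?_))
    rw [one_mul, hp _ ⟨g, rfl⟩]
  obtain ⟨g', hg'⟩ := hclosed (m⁻¹ * r g) fun p hp => by
    obtain ⟨q, hq⟩ := exists_evalMat_eq_evalMat_mul m⁻¹ p
    rw [← hq]
    refine hx q (Ideal.mem_sup_right (mem_cosetIdeal.2 fun g' => ?_))
    rw [hq, nonsing_inv_mul_cancel_left _ _ hunit, hp _ ⟨g', rfl⟩]
  refine hm ⟨g * g'⁻¹, ?_⟩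
  have hinv : r g' * r g'⁻¹ = 1 := by rw [← map_mul, mul_inv_cancel, map_one]
  have hg : r g = m * r g' := by rw [hg', mul_nonsing_inv_cancel_left _ _ hunit]
  rw [map_mul, hg, mul_assoc, hinv, mul_one]

theorem mem_range_of_forall_evalMat_eq (hG : IsReductive G)
    (hr : ∀ i j, (fun g => r g i j) ∈ regularFunctions G) (hdet : ∀ g, (r g).det = 1)
    (hclosed : IsZariskiClosed (Set.range r))
    {m : Matrix ι ι ℂ} (hm : ∀ f ∈ matInvariants r, evalMat m f = evalMat 1 f) :
    m ∈ Set.range r := by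
  by_contra hmr
  have hmdet : m.det = 1 := by
    simpa [evalMat_det] using hm _ (det_mem_matInvariants hdet)
  obtain ⟨f, hf, hf1, hfm⟩ := exists_matInvariants_of_sup_eq_top hG hr
    rightTranslate_mem_cosetIdeal rightTranslate_mem_cosetIdeal
    (cosetIdeal_one_sup_eq_top hclosed hmdet hmr)
  have h0 : evalMat 1 f = 0 := by simpa using mem_cosetIdeal.1 hf1 1
  have h1 : evalMat m (1 - f) = 0 := by simpa using mem_cosetIdeal.1 hfm 1
  rw [map_sub, map_one, hm f hf, h0, sub_zero] at h1
  exact one_ne_zero h1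

end Hilbert

section Fischer

open MvPolynomial ComplexConjugate Nat

variable {σ 𝕜 : Type*} [RCLike 𝕜]

/-- The factorial `α! = ∏ i, (α i)!` of a multi-index. -/
def multiFactorial (α : σ →₀ ℕ) : ℕ :=
  α.prod fun _ k => k !

theorem multiFactorial_pos (α : σ →₀ ℕ) : 0 < multiFactorial α :=
  Finset.prod_pos fun _ _ => Nat.factorial_pos _

theorem multiFactorial_single_add (s : σ) (α : σ →₀ ℕ) :
    multiFactorial (Finsupp.single s 1 + α) = multiFactorial α * (α s + 1) := by
  have split (β : σ →₀ ℕ) : multiFactorial β = (β s)! * multiFactorial (β.erase s) :=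
    (Finsupp.mul_prod_erase' β s _ fun _ => Nat.factorial_zero).symm
  rw [split (Finsupp.single s 1 + α), split α, Finsupp.erase_add, Finsupp.erase_single, zero_add,
    Finsupp.add_apply, Finsupp.single_eq_same, Nat.add_comm 1, Nat.factorial_succ]
  ring

theorem fischerSum_support_eq {p q : MvPolynomial σ 𝕜} {s : Finset (σ →₀ ℕ)} (hs : p.support ⊆ s) :
    ∑ α ∈ p.support, (multiFactorial α : 𝕜) * (conj (coeff α p) * coeff α q) =
      ∑ α ∈ s, (multiFactorial α : 𝕜) * (conj (coeff α p) * coeff α q) := by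
  refine Finset.sum_subset hs fun α _ hα => ?_
  rw [notMem_support_iff.1 hα, map_zero, zero_mul, mul_zero]

/-- The Fischer inner product on polynomials, for which multiplication by a variable is adjoint to
the corresponding partial derivative. -/
def fischer : MvPolynomial σ 𝕜 →ₗ⋆[𝕜] MvPolynomial σ 𝕜 →ₗ[𝕜] 𝕜 :=
  LinearMap.mk₂'ₛₗ (starRingEnd 𝕜) (RingHom.id 𝕜)
    (fun p q => ∑ α ∈ p.support, (multiFactorial α : 𝕜) * (conj (coeff α p) * coeff α q))
    (fun p p' q => by
      classical
      rw [fischerSum_support_eq (s := p.support ∪ p'.support) support_add,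
        fischerSum_support_eq (p := p) Finset.subset_union_left,
        fischerSum_support_eq (p := p') Finset.subset_union_right, ← Finset.sum_add_distrib]
      simp only [coeff_add, map_add, add_mul, mul_add])
    (fun c p q => by
      rw [fischerSum_support_eq (support_smul (f := p)), smul_eq_mul, Finset.mul_sum]
      simp only [coeff_smul, smul_eq_mul, map_mul, mul_assoc, mul_left_comm])
    (fun p q q' => by
      simp only [coeff_add, mul_add, Finset.sum_add_distrib])
    (fun c p q => by
      simp only [coeff_smul, smul_eq_mul, Finset.mul_sum, RingHom.id_apply, mul_left_comm])

theorem fischer_eq_sum {p : MvPolynomial σ 𝕜} {s : Finset (σ →₀ ℕ)} (hs : p.support ⊆ s)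
    (q : MvPolynomial σ 𝕜) :
    fischer p q = ∑ α ∈ s, (multiFactorial α : 𝕜) * (conj (coeff α p) * coeff α q) :=
  fischerSum_support_eq hs

theorem conj_fischer (p q : MvPolynomial σ 𝕜) : conj (fischer p q) = fischer q p := by
  classical
  rw [fischer_eq_sum (p := p) (s := p.support ∪ q.support) Finset.subset_union_left,
    fischer_eq_sum (p := q) (s := p.support ∪ q.support) Finset.subset_union_right, map_sum]
  simp only [map_mul, RCLike.conj_conj, map_natCast, mul_comm (coeff _ p)]

theorem fischer_monomial_left (β : σ →₀ ℕ) (c : 𝕜) (q : MvPolynomial σ 𝕜) :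
    fischer (monomial β c) q = (multiFactorial β : 𝕜) * (conj c * coeff β q) := by
  classical
  rw [fischer_eq_sum (s := {β}) support_monomial_subset, Finset.sum_singleton, coeff_monomial,
    if_pos rfl]

theorem fischer_X_mul_left (s : σ) (p q : MvPolynomial σ 𝕜) :
    fischer (X s * p) q = fischer p (pderiv s q) := by
  induction p using MvPolynomial.induction_on' with
  | add p p' hp hp' => simp only [mul_add, map_add, LinearMap.add_apply, hp, hp']
  | monomial β c =>
    rw [X, monomial_mul, one_mul, fischer_monomial_left, fischer_monomial_left, coeff_pderiv,
      multiFactorial_single_add, add_comm β]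
    push_cast
    ring

theorem fischer_X_mul_right (s : σ) (p q : MvPolynomial σ 𝕜) :
    fischer p (X s * q) = fischer (pderiv s p) q := by
  rw [← conj_fischer, fischer_X_mul_left, conj_fischer]

theorem re_fischer_self {p : MvPolynomial σ 𝕜} {s : Finset (σ →₀ ℕ)} (hs : p.support ⊆ s) :
    RCLike.re (fischer p p) = ∑ α ∈ s, multiFactorial α * ‖coeff α p‖ ^ 2 := by
  simp only [fischer_eq_sum hs, RCLike.conj_mul, map_sum]
  norm_cast

theorem fischer_self_nonneg (p : MvPolynomial σ 𝕜) : 0 ≤ RCLike.re (fischer p p) := by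
  rw [re_fischer_self subset_rfl]
  positivity

theorem eq_zero_of_re_fischer_self_eq_zero {p : MvPolynomial σ 𝕜}
    (h : RCLike.re (fischer p p) = 0) : p = 0 := by
  rw [re_fischer_self subset_rfl, Finset.sum_eq_zero_iff_of_nonneg fun _ _ => by positivity] at h
  ext α
  by_contra hα
  have := multiFactorial_pos α
  exact hα (by simpa [this.ne'] using h α (mem_support_iff.2 hα))

theorem norm_eval_sq_le_fischer {p : MvPolynomial σ 𝕜} {s : Finset (σ →₀ ℕ)} (hs : p.support ⊆ s)
    (x : σ → 𝕜) :
    ‖eval x p‖ ^ 2 ≤ (∑ α ∈ s, ‖eval x (monomial α 1)‖ ^ 2) * RCLike.re (fischer p p) := by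
  have heval : eval x p = ∑ α ∈ s, coeff α p * eval x (monomial α 1) := by
    conv_lhs => rw [p.as_sum, map_sum]
    rw [Finset.sum_subset hs fun α _ hα => by rw [notMem_support_iff.1 hα, map_zero, map_zero]]
    exact Finset.sum_congr rfl fun α _ => by simp only [eval_monomial, one_mul]
  calc ‖eval x p‖ ^ 2
      ≤ (∑ α ∈ s, ‖coeff α p‖ * ‖eval x (monomial α 1)‖) ^ 2 := by
        rw [heval]
        gcongr
        exact (norm_sum_le _ _).trans_eq (by simp only [norm_mul])
    _ ≤ (∑ α ∈ s, ‖coeff α p‖ ^ 2) * ∑ α ∈ s, ‖eval x (monomial α 1)‖ ^ 2 :=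
        Finset.sum_mul_sq_le_sq_mul_sq _ _ _
    _ ≤ (∑ α ∈ s, ‖eval x (monomial α 1)‖ ^ 2) * RCLike.re (fischer p p) := by
        rw [mul_comm, re_fischer_self hs]
        gcongr with α
        exact le_mul_of_one_le_left (sq_nonneg _) (by exact_mod_cast multiFactorial_pos α)

variable {ι : Type*} [Fintype ι]

theorem lieDer_apply_eq_sum {R : Type*} [CommRing R] (A : Matrix ι ι R)
    (f : MvPolynomial (ι × ι) R) :
    lieDer A f = ∑ r, ∑ b, ∑ a, A a b • (X (r, a) * pderiv (r, b) f) := by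
  classical
  let D : Derivation R (MvPolynomial (ι × ι) R) (MvPolynomial (ι × ι) R) :=
    ∑ r, ∑ b, ∑ a, A a b • (X (r, a) : MvPolynomial (ι × ι) R) • pderiv (r, b)
  have hD (g : MvPolynomial (ι × ι) R) :
      D g = ∑ r, ∑ b, ∑ a, A a b • (X (r, a) * pderiv (r, b) g) := by
    simp only [D, ← Derivation.coeFnAddMonoidHom_apply, map_sum, Finset.sum_apply]
    rfl
  rw [← hD]
  congr 1
  refine derivation_ext fun p => ?_
  simp [lieDer_X, hD, pderiv_X, Pi.single_apply, Prod.ext_iff, ite_and]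

theorem fischer_lieDer_right (A : Matrix ι ι 𝕜) (p q : MvPolynomial (ι × ι) 𝕜) :
    fischer p (lieDer A q) = fischer (lieDer Aᴴ p) q := by
  simp only [lieDer_apply_eq_sum, map_sum, map_smul, map_smulₛₗ, LinearMap.sum_apply,
    LinearMap.smul_apply, fischer_X_mul_right, fischer_X_mul_left, conjTranspose_apply]
  refine Finset.sum_congr rfl fun r _ => ?_
  rw [Finset.sum_comm]
  simp

end Fischer

section MatLie

open MvPolynomial

variable {ι M R : Type*} [Fintype ι] [DecidableEq ι] [Monoid M] [CommRing R]

/-- The Lie algebra of the group of matrices fixing the invariants of `r`. -/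
def matLie (r : M →* Matrix ι ι R) : Submodule R (Matrix ι ι R) where
  carrier := {A | ∀ f ∈ matInvariants r, lieDer A f = 0}
  zero_mem' f _ := by rw [map_zero, Derivation.zero_apply]
  add_mem' hA hB f hf := by rw [map_add, Derivation.add_apply, hA f hf, hB f hf, add_zero]
  smul_mem' c A hA f hf := by rw [map_smul, Derivation.smul_apply, hA f hf, smul_zero]

theorem lie_mem_matLie {r : M →* Matrix ι ι R} {A B : Matrix ι ι R} (hA : A ∈ matLie r)
    (hB : B ∈ matLie r) : ⁅A, B⁆ ∈ matLie r := fun f hf => by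
  rw [lieDer_lie, Derivation.commutator_apply, hA f hf, hB f hf, map_zero, map_zero, sub_zero]

theorem mem_matLie_of_adjoin_eq {J : Type*} {r : M →* Matrix ι ι R}
    {f : J → MvPolynomial (ι × ι) R} (hf : Algebra.adjoin R (Set.range f) = matInvariants r)
    {A : Matrix ι ι R} (hA : ∀ j, lieDer A (f j) = 0) : A ∈ matLie r := fun p hp => by
  have hEq : Set.EqOn (lieDer A) (0 : Derivation R (MvPolynomial (ι × ι) R) _) (Set.range f) := by
    rintro _ ⟨j, rfl⟩
    exact hA j
  exact Derivation.eqOn_adjoin hEq (hf ▸ hp)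

theorem hasDerivAt_exp_smul_apply (A : Matrix ι ι ℂ) (t : ℂ) (i j : ι) :
    HasDerivAt (fun s : ℂ => (NormedSpace.exp (s • A) : Matrix ι ι ℂ) i j)
      ((NormedSpace.exp (t • A) * A) i j) t := by
  open scoped Matrix.Norms.Operator in
  exact (Matrix.entryLinearMap ℂ ℂ i j :
    Matrix ι ι ℂ →ₗ[ℂ] ℂ).toContinuousLinearMap.hasFDerivAt.comp_hasDerivAt t
      (hasDerivAt_exp_smul_const A t)

theorem hasDerivAt_dual_rightTranslate_exp (A : Matrix ι ι ℂ)
    (l : MvPolynomial (ι × ι) ℂ →ₗ[ℂ] ℂ) (f : MvPolynomial (ι × ι) ℂ) (t : ℂ) :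
    HasDerivAt (fun s : ℂ => l (rightTranslate (NormedSpace.exp (s • A)) f))
      (l (rightTranslate (NormedSpace.exp (t • A)) (lieDer A f))) t :=
  hasDerivAt_dual_rightTranslate (hasDerivAt_exp_smul_apply A t) l f

theorem rightTranslate_exp_zero_smul (A : Matrix ι ι ℂ) (f : MvPolynomial (ι × ι) ℂ) :
    rightTranslate (NormedSpace.exp ((0 : ℂ) • A)) f = f := by
  rw [zero_smul, NormedSpace.exp_zero, rightTranslate_one, AlgHom.id_apply]

theorem rightTranslate_exp_smul_eq_self_iff {A : Matrix ι ι ℂ} {f : MvPolynomial (ι × ι) ℂ} :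
    (∀ t : ℂ, rightTranslate (NormedSpace.exp (t • A)) f = f) ↔ lieDer A f = 0 := by
  refine ⟨fun h => ?_, fun h t => ?_⟩ <;> ext α
  · have hderiv := hasDerivAt_dual_rightTranslate_exp A (lcoeff ℂ α) f 0
    simp only [h, rightTranslate_exp_zero_smul] at hderiv
    exact hderiv.unique (hasDerivAt_const _ _)
  · have hderiv (t : ℂ) := hasDerivAt_dual_rightTranslate_exp A (lcoeff ℂ α) f t
    simp only [h, map_zero] at hderiv
    have hconst := is_const_of_deriv_eq_zero (fun t => (hderiv t).differentiableAt)
      (fun t => (hderiv t).deriv) t 0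
    rwa [rightTranslate_exp_zero_smul] at hconst

theorem det_exp_smul_eq_one {A : Matrix ι ι ℂ} (hA : lieDer A (mvPolynomialX ι ι ℂ).det = 0)
    (t : ℂ) : (NormedSpace.exp (t • A)).det = 1 := by
  have h := congrArg (evalMat 1) (rightTranslate_exp_smul_eq_self_iff.2 hA t)
  rwa [evalMat_rightTranslate, evalMat_det, evalMat_det, one_mul, det_one] at h

theorem mem_matLie_iff_exp {n : ℕ} {G : Subgroup (GL (Fin n) ℂ)} (hG : IsReductive G)
    {r : G →* Matrix ι ι ℂ} (hr : ∀ i j, (fun g => r g i j) ∈ regularFunctions G)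
    (hdet : ∀ g, (r g).det = 1)
    (hclosed : IsZariskiClosed (Set.range r)) (A : Matrix ι ι ℂ) :
    A ∈ matLie r ↔ ∀ t : ℂ, NormedSpace.exp (t • A) ∈ Set.range r := by
  refine ⟨fun hA t => mem_range_of_forall_evalMat_eq hG hr hdet hclosed fun f hf => ?_,
    fun h f hf => rightTranslate_exp_smul_eq_self_iff.1 fun t => ?_⟩
  · have h := congrArg (evalMat 1) (rightTranslate_exp_smul_eq_self_iff.2 (hA f hf) t)
    rwa [evalMat_rightTranslate, one_mul] at h
  · obtain ⟨g, hg⟩ := h t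
    rw [← hg, hf g]

end MatLie

section Minimum

open MvPolynomial ComplexConjugate

/-- The square of the Fischer norm of a finite family of polynomials. -/
def fischerNormSq {σ J 𝕜 : Type*} [RCLike 𝕜] [Fintype J] (f : J → MvPolynomial σ 𝕜) : ℝ :=
  ∑ j, RCLike.re (fischer (f j) (f j))

theorem fischerNormSq_eq_sum {σ J 𝕜 : Type*} [RCLike 𝕜] [Fintype J] {f : J → MvPolynomial σ 𝕜}
    {s : Finset (σ →₀ ℕ)} (hs : ∀ j, (f j).support ⊆ s) :
    fischerNormSq f = ∑ j, ∑ α ∈ s, multiFactorial α * ‖coeff α (f j)‖ ^ 2 :=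
  Finset.sum_congr rfl fun j _ => re_fischer_self (hs j)

theorem exists_isMinOn_of_isBounded_sublevel {E : Type*} [PseudoMetricSpace E] [ProperSpace E]
    {K : Set E} (hK : IsClosed K) (hne : K.Nonempty) {Ψ : E → ℝ} (hΨ : Continuous Ψ)
    (hbdd : ∀ c, Bornology.IsBounded (K ∩ {y | Ψ y ≤ c})) : ∃ y ∈ K, IsMinOn Ψ K y := by
  obtain ⟨y₀, hy₀⟩ := hne
  have hcompact : IsCompact (K ∩ {y | Ψ y ≤ Ψ y₀}) := Metric.isCompact_of_isClosed_isBounded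
    (hK.inter (isClosed_le hΨ continuous_const)) (hbdd _)
  obtain ⟨y, ⟨hyK, hy⟩, hmin⟩ := hcompact.exists_isMinOn ⟨y₀, hy₀, le_refl (Ψ y₀)⟩ hΨ.continuousOn
  refine ⟨y, hyK, fun z hz => ?_⟩
  rcases le_total (Ψ z) (Ψ y₀) with h | h
  · exact hmin ⟨hz, h⟩
  · exact hy.trans h

variable {ι J : Type*} [Fintype ι]

theorem exists_finset_support_rightTranslate_subset {R : Type*} [CommRing R] [Finite J]
    (f : J → MvPolynomial (ι × ι) R) :
    ∃ s : Finset (ι × ι →₀ ℕ), ∀ m j, (rightTranslate m (f j)).support ⊆ s := by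
  have := Fintype.ofFinite J
  let D := Finset.univ.sup fun j => (f j).totalDegree
  refine ⟨(Finsupp.finite_of_degree_le (σ := ι × ι) D).toFinset, fun m j α hα => ?_⟩
  rw [Set.Finite.mem_toFinset]
  exact (le_totalDegree hα).trans <| (totalDegree_rightTranslate_le m (f j)).trans <|
    Finset.le_sup (f := fun j => (f j).totalDegree) (Finset.mem_univ j)

theorem exists_norm_evalMat_sq_le_fischerNormSq {𝕜 : Type*} [RCLike 𝕜] [Fintype J]
    (f : J → MvPolynomial (ι × ι) 𝕜) : ∃ c : ℝ, 0 ≤ c ∧ ∀ m j,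
      ‖evalMat m (f j)‖ ^ 2 ≤ c * fischerNormSq fun j => rightTranslate m (f j) := by
  classical
  obtain ⟨s, hs⟩ := exists_finset_support_rightTranslate_subset f
  refine ⟨∑ α ∈ s, ‖evalMat 1 (monomial α (1 : 𝕜))‖ ^ 2, by positivity, fun m j => ?_⟩
  have hone : evalMat m (f j) = evalMat 1 (rightTranslate m (f j)) := by
    rw [evalMat_rightTranslate, one_mul]
  rw [hone]
  refine (norm_eval_sq_le_fischer (hs m j) _).trans (mul_le_mul_of_nonneg_left ?_ (by positivity))
  exact Finset.single_le_sum (f := fun j => RCLike.re (fischer (rightTranslate m (f j))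
      (rightTranslate m (f j)))) (fun _ _ => fischer_self_nonneg _) (Finset.mem_univ j)

variable [DecidableEq ι]

theorem exists_eval_eq_dual_rightTranslate {M K : Type*} [Monoid M] [Field K] [Infinite K]
    {r : M →* Matrix ι ι K} {f : J → MvPolynomial (ι × ι) K}
    (hf : Algebra.adjoin K (Set.range f) = matInvariants r)
    (l : Module.Dual K (MvPolynomial (ι × ι) K)) {p : MvPolynomial (ι × ι) K}
    (hp : p ∈ matInvariants r) :
    ∃ P : MvPolynomial J K, ∀ m, eval (fun j => evalMat m (f j)) P = l (rightTranslate m p) := by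
  obtain ⟨c, hc⟩ := exists_evalMat_eq_dual_rightTranslate l p
  have hcr : c ∈ matInvariants r := fun g => evalMat_ext fun x => by
    rw [evalMat_rightTranslate, hc, hc, rightTranslate_mul, AlgHom.comp_apply, hp g]
  rw [← hf, Algebra.adjoin_range_eq_range_aeval] at hcr
  obtain ⟨P, rfl⟩ := hcr
  refine ⟨P, fun m => ?_⟩
  rw [← hc m]
  change _ = evalMat m (aeval f P)
  rw [← AlgHom.comp_apply, comp_aeval, aeval_eq_eval]

variable [Fintype J]

theorem exists_continuous_fischerNormSq {M 𝕜 : Type*} [Monoid M] [RCLike 𝕜]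
    {r : M →* Matrix ι ι 𝕜} {f : J → MvPolynomial (ι × ι) 𝕜}
    (hf : Algebra.adjoin 𝕜 (Set.range f) = matInvariants r) :
    ∃ Ψ : (J → 𝕜) → ℝ, Continuous Ψ ∧ ∀ m, Ψ (fun j => evalMat m (f j)) =
      fischerNormSq fun j => rightTranslate m (f j) := by
  obtain ⟨s, hs⟩ := exists_finset_support_rightTranslate_subset f
  choose P hP using fun (j : J) (α : ι × ι →₀ ℕ) =>
    exists_eval_eq_dual_rightTranslate hf (lcoeff 𝕜 α) (hf.le (Algebra.subset_adjoin ⟨j, rfl⟩))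
  refine ⟨fun y => ∑ j, ∑ α ∈ s, multiFactorial α * ‖eval y (P j α)‖ ^ 2, ?_, fun m => ?_⟩
  · exact continuous_finsetSum _ fun j _ => continuous_finsetSum _ fun α _ =>
      continuous_const.mul ((P j α).continuous_eval.norm.pow 2)
  · simp only [fischerNormSq_eq_sum (hs m), hP, lcoeff_apply]

theorem exists_fischerNormSq_rightTranslate_le {n : ℕ} {G : Subgroup (GL (Fin n) ℂ)}
    (hG : IsReductive G) {r : G →* Matrix ι ι ℂ}
    (hr : ∀ i j, (fun g => r g i j) ∈ regularFunctions G) (hdet : ∀ g, (r g).det = 1)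
    {f : J → MvPolynomial (ι × ι) ℂ} (hf : Algebra.adjoin ℂ (Set.range f) = matInvariants r) :
    ∃ m : Matrix ι ι ℂ, m.det = 1 ∧ ∀ u : Matrix ι ι ℂ, u.det = 1 →
      fischerNormSq (fun j => rightTranslate m (f j)) ≤
        fischerNormSq fun j => rightTranslate u (f j) := by
  obtain ⟨Ψ, hΨ, hΨf⟩ := exists_continuous_fischerNormSq hf
  obtain ⟨c, hc, hle⟩ := exists_norm_evalMat_sq_le_fischerNormSq f
  obtain ⟨_, ⟨m, hm, rfl⟩, hmin⟩ := exists_isMinOn_of_isBounded_sublevel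
    (isClosed_image_evalMat hG hr hdet hf) ⟨_, 1, det_one, rfl⟩ hΨ fun a => by
      refine Metric.isBounded_closedBall.subset (t := Metric.closedBall 0 √(c * a)) ?_
      rintro _ ⟨⟨m, -, rfl⟩, hma⟩
      rw [mem_closedBall_zero_iff, pi_norm_le_iff_of_nonneg (Real.sqrt_nonneg _)]
      refine fun j => Real.le_sqrt_of_sq_le ((hle m j).trans ?_)
      rw [← hΨf]
      exact mul_le_mul_of_nonneg_left hma hc
  refine ⟨m, hm, fun u hu => ?_⟩
  rw [← hΨf, ← hΨf]
  exact hmin ⟨u, hu, rfl⟩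

theorem hasDerivAt_fischerNormSq_exp (f : J → MvPolynomial (ι × ι) ℂ) (A : Matrix ι ι ℂ) :
    HasDerivAt
      (fun t : ℝ => fischerNormSq fun j => rightTranslate (NormedSpace.exp ((t : ℂ) • A)) (f j))
      (2 * (∑ j, fischer (f j) (lieDer A (f j))).re) 0 := by
  obtain ⟨s, hs⟩ := exists_finset_support_rightTranslate_subset f
  have hsf (j : J) : (f j).support ⊆ s := by
    simpa only [rightTranslate_one, AlgHom.id_apply] using hs 1 j
  have hderiv : 2 * (∑ j, fischer (f j) (lieDer A (f j))).re = ∑ j, ∑ α ∈ s,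
      (multiFactorial α : ℝ) * (2 * inner ℝ (coeff α (f j)) (coeff α (lieDer A (f j)))) := by
    simp only [fischer_eq_sum (hsf _), Complex.re_sum, Finset.mul_sum]
    refine Finset.sum_congr rfl fun j _ => Finset.sum_congr rfl fun α _ => ?_
    rw [← Complex.ofReal_natCast, Complex.re_ofReal_mul, Complex.inner, mul_comm (conj _)]
    ring
  simp only [fischerNormSq_eq_sum (hs _), hderiv]
  refine HasDerivAt.fun_sum fun j _ => HasDerivAt.fun_sum fun α _ => HasDerivAt.const_mul _ ?_
  have hcoeff :=
    (hasDerivAt_dual_rightTranslate_exp A (lcoeff ℂ α) (f j) ((0 : ℝ) : ℂ)).comp_ofReal.norm_sq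
  simpa only [Complex.ofReal_zero, rightTranslate_exp_zero_smul, lcoeff_apply] using hcoeff

theorem sum_fischer_lieDer_eq_zero {f : J → MvPolynomial (ι × ι) ℂ}
    (hmin : ∀ u : Matrix ι ι ℂ, u.det = 1 →
      fischerNormSq f ≤ fischerNormSq fun j => rightTranslate u (f j))
    {A : Matrix ι ι ℂ} (hA : lieDer A (mvPolynomialX ι ι ℂ).det = 0) :
    ∑ j, fischer (f j) (lieDer A (f j)) = 0 := by
  have hre {A : Matrix ι ι ℂ} (hA : lieDer A (mvPolynomialX ι ι ℂ).det = 0) :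
      (∑ j, fischer (f j) (lieDer A (f j))).re = 0 := by
    have hloc : IsLocalMin (fun t : ℝ => fischerNormSq fun j =>
        rightTranslate (NormedSpace.exp ((t : ℂ) • A)) (f j)) 0 := .of_forall fun t => by
      simp only [Complex.ofReal_zero, rightTranslate_exp_zero_smul]
      exact hmin _ (det_exp_smul_eq_one hA _)
    simpa using hloc.hasDerivAt_eq_zero (hasDerivAt_fischerNormSq_exp f A)
  refine Complex.ext (hre hA) ?_
  have him := hre (A := Complex.I • A) (by rw [map_smul, Derivation.smul_apply, hA, smul_zero])
  simp only [map_smul, Derivation.smul_apply, smul_eq_mul,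
    ← Finset.mul_sum, Complex.I_mul_re, neg_eq_zero] at him
  exact him

theorem lieDer_lie_det_eq_zero {𝕜 : Type*} [NontriviallyNormedField 𝕜] (A B : Matrix ι ι 𝕜) :
    lieDer ⁅A, B⁆ (mvPolynomialX ι ι 𝕜).det = 0 := by
  obtain ⟨c, hc⟩ := exists_lieDer_det_eq_smul A
  obtain ⟨d, hd⟩ := exists_lieDer_det_eq_smul B
  rw [lieDer_lie, Derivation.commutator_apply, hc, hd, Derivation.map_smul, Derivation.map_smul,
    hc, hd, smul_comm, sub_self]

theorem lieDer_conjTranspose_eq_zero {f : J → MvPolynomial (ι × ι) ℂ}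
    (hmin : ∀ u : Matrix ι ι ℂ, u.det = 1 →
      fischerNormSq f ≤ fischerNormSq fun j => rightTranslate u (f j))
    {B : Matrix ι ι ℂ} (hB : ∀ j, lieDer B (f j) = 0) (j : J) : lieDer Bᴴ (f j) = 0 := by
  have hnorm (j : J) : fischer (f j) (lieDer ⁅B, Bᴴ⁆ (f j)) =
      fischer (lieDer Bᴴ (f j)) (lieDer Bᴴ (f j)) := by
    rw [lieDer_lie, Derivation.commutator_apply, hB, map_zero, sub_zero, fischer_lieDer_right]
  have hsum := congrArg RCLike.re (sum_fischer_lieDer_eq_zero hmin (lieDer_lie_det_eq_zero B Bᴴ))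
  simp only [hnorm, map_sum, map_zero] at hsum
  rw [Finset.sum_eq_zero_iff_of_nonneg fun j _ => fischer_self_nonneg _] at hsum
  exact eq_zero_of_re_fischer_self_eq_zero (hsum j (Finset.mem_univ j))

theorem exists_conjTranspose_mem_matLie {n : ℕ} {G : Subgroup (GL (Fin n) ℂ)} (hG : IsReductive G)
    {r : G →* Matrix ι ι ℂ} (hr : ∀ i j, (fun g => r g i j) ∈ regularFunctions G)
    (hdet : ∀ g, (r g).det = 1) :
    ∃ m : Matrix ι ι ℂ, m.det = 1 ∧ ∀ A ∈ matLie r, m⁻¹ * (m * A * m⁻¹)ᴴ * m ∈ matLie r := by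
  obtain ⟨T, hT⟩ := fg_matInvariants hG hr
  have hf : Algebra.adjoin ℂ (Set.range (Subtype.val : T → MvPolynomial (ι × ι) ℂ)) =
      matInvariants r := by
    rw [Subtype.range_coe, ← hT]
  obtain ⟨m, hm, hmin⟩ := exists_fischerNormSq_rightTranslate_le hG hr hdet hf
  have hunit : IsUnit m.det := hm ▸ isUnit_one
  refine ⟨m, hm, fun A hA => mem_matLie_of_adjoin_eq hf fun j => ?_⟩
  have hmin' (u : Matrix ι ι ℂ) (hu : u.det = 1) : fischerNormSq (fun j : T => rightTranslate m j) ≤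
      fischerNormSq fun j : T => rightTranslate u (rightTranslate m j) := by
    simpa only [rightTranslate_mul, AlgHom.comp_apply] using
      hmin (u * m) (by rw [det_mul, hu, hm, one_mul])
  have hB (j : T) : lieDer (m * A * m⁻¹) (rightTranslate m (j : MvPolynomial (ι × ι) ℂ)) = 0 := by
    rw [lieDer_rightTranslate (Matrix.nonsing_inv_mul_cancel_right m _ hunit),
      hA _ (hf.le (Algebra.subset_adjoin ⟨j, rfl⟩)), map_zero]
  have hBH := lieDer_conjTranspose_eq_zero hmin' hB j
  rw [lieDer_rightTranslate (B := m⁻¹ * (m * A * m⁻¹)ᴴ * m) (by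
    rw [Matrix.mul_assoc m⁻¹, Matrix.mul_nonsing_inv_cancel_left m _ hunit])] at hBH
  have hinv := congrArg (rightTranslate m⁻¹) hBH
  rwa [← AlgHom.comp_apply, ← rightTranslate_mul, Matrix.nonsing_inv_mul m hunit,
    rightTranslate_one, AlgHom.id_apply, map_zero] at hinv

end Minimum

section Model

open MvPolynomial

theorem mem_of_isClosed_zariski {n : ℕ} {Z : Set (GL (Fin n) ℂ)} (hZ : @IsClosed _ (zariski n) Z)
    {g : GL (Fin n) ℂ} (hg : ∀ p, (∀ h ∈ Z, evalMat h.1 p = 0) → evalMat g.1 p = 0) : g ∈ Z := by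
  let := zariski n
  by_contra hgZ
  have hbasis := TopologicalSpace.isTopologicalBasis_of_subbasis_of_inter
    (α := GL (Fin n) ℂ) rfl <| by
    rintro _ ⟨p, rfl⟩ _ ⟨q, rfl⟩
    exact ⟨p * q, by ext; simp⟩
  obtain ⟨U, hU, hgU, hUZ⟩ :=
    hbasis.exists_subset_of_mem_open (show g ∈ Zᶜ from hgZ) hZ.isOpen_compl
  obtain ⟨p, rfl⟩ : ∃ p, U = {g : GL (Fin n) ℂ | evalMat g.1 p ≠ 0} := by
    obtain rfl | ⟨p, rfl⟩ := hU
    · exact ⟨1, by ext; simp⟩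
    · exact ⟨p, by simp only [evalMat, aeval_eq_eval]⟩
  exact hgU (hg p fun h hh => by_contra fun hne => hUZ (show h ∈ _ from hne) hh)

theorem evalMat_rename {ι κ R : Type*} [CommRing R] (x : Matrix ι ι R) (e : κ → ι)
    (p : MvPolynomial (κ × κ) R) :
    evalMat x (rename (Prod.map e e) p) = evalMat (x.submatrix e e) p := by
  rw [evalMat, aeval_rename]
  rfl

variable {n : ℕ} {G : Subgroup (GL (Fin n) ℂ)} {ι : Type*}

theorem exists_evalMat_div_det_pow {f : G → ℂ} (hf : f ∈ regularFunctions G) :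
    ∃ p k, ∀ g : G, f g = evalMat (g : GL (Fin n) ℂ).1 p / (g : GL (Fin n) ℂ).1.det ^ k := by
  obtain ⟨p, k, h⟩ := hf
  exact ⟨p, k, fun g => (h g).trans (by rw [evalMat, aeval_eq_eval])⟩

/-- The relation `q * det g = 1` on the image makes the `e`-block of its Zariski limit points
invertible. -/
theorem isZariskiClosed_range (hG : @IsClosed _ (zariski n) (G : Set (GL (Fin n) ℂ)))
    {r : G → Matrix ι ι ℂ} (hr : ∀ i j, (fun g => r g i j) ∈ regularFunctions G) {e : Fin n → ι}
    (he : ∀ g, (r g).submatrix e e = (g : GL (Fin n) ℂ).1) {q : MvPolynomial (ι × ι) ℂ}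
    (hq : ∀ g, evalMat (r g) q * (g : GL (Fin n) ℂ).1.det = 1) :
    IsZariskiClosed (Set.range r) := by
  intro x hx
  simp only [Set.forall_mem_range] at hx
  let d := rename (Prod.map e e) (mvPolynomialX (Fin n) (Fin n) ℂ).det
  have hd (y : Matrix ι ι ℂ) : evalMat y d = (y.submatrix e e).det := by
    rw [evalMat_rename, evalMat_det]
  have hxq : evalMat x (q * d - 1) = 0 := hx _ fun g => by
    rw [map_sub, map_mul, map_one, hd, he, hq, sub_self]
  rw [map_sub, map_mul, map_one, sub_eq_zero, hd] at hxq
  have hdet : (x.submatrix e e).det ≠ 0 := right_ne_zero_of_mul_eq_one hxq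
  have hg : GeneralLinearGroup.mkOfDetNeZero _ hdet ∈ G := mem_of_isClosed_zariski hG fun p hp => by
    have := hx (rename (Prod.map e e) p) fun g => by rw [evalMat_rename, he, hp _ g.2]
    rwa [evalMat_rename] at this
  refine ⟨⟨_, hg⟩, Matrix.ext fun i j => ?_⟩
  obtain ⟨p, k, hp⟩ := exists_evalMat_div_det_pow (hr i j)
  have hxp := hx (rename (Prod.map e e) p - d ^ k * X (i, j)) fun g => by
    rw [map_sub, map_mul, map_pow, hd, evalMat_rename, he, evalMat_X, hp,
      mul_div_cancel₀ _ (pow_ne_zero _ (GeneralLinearGroup.det_ne_zero _)), sub_self]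
  rw [map_sub, map_mul, map_pow, hd, evalMat_rename, evalMat_X, sub_eq_zero] at hxp
  rw [hp, div_eq_iff (pow_ne_zero _ (GeneralLinearGroup.det_ne_zero _)), mul_comm]
  exact hxp

variable {V : Type*} [AddCommGroup V] [Module ℂ V]

theorem det_rep_mem_regularFunctions [FiniteDimensional ℂ V] {ρ : Representation ℂ G V}
    (hρ : IsRational ρ) : (fun g => LinearMap.det (ρ g)) ∈ regularFunctions G := by
  let b := Module.finBasis ℂ V
  simp only [← LinearMap.det_toMatrix b]
  refine det_mem_subalgebra _ fun i j => ?_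
  simpa only [LinearMap.toMatrix_apply] using! hρ (b.coord i) (b j)

/-- The block diagonal representation `g ↦ diag (g, ρ g, (det g * det (ρ g))⁻¹)`; the last entry
brings the determinant to `1`. -/
def blockRep {κ : Type*} [Fintype κ] [DecidableEq κ] (ρ : Representation ℂ G V)
    (b : Module.Basis κ ℂ V) : G →* Matrix (Fin n ⊕ (κ ⊕ Unit)) (Fin n ⊕ (κ ⊕ Unit)) ℂ where
  toFun g := fromBlocks (g : GL (Fin n) ℂ).1 0 0 (fromBlocks (LinearMap.toMatrix b b (ρ g)) 0 0
    (scalar Unit ((g : GL (Fin n) ℂ).1.det⁻¹ * LinearMap.det (ρ g⁻¹))))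
  map_one' := by simp [LinearMap.toMatrix_one]
  map_mul' g h := by
    simp only [fromBlocks_multiply, ← map_mul (scalar Unit), LinearMap.toMatrix_mul, map_mul ρ,
      Subgroup.coe_mul, Units.val_mul, det_mul, Matrix.mul_zero, Matrix.zero_mul, add_zero,
      zero_add, _root_.mul_inv_rev, map_mul LinearMap.det]
    congr 3
    ring

section BlockRep

variable {κ : Type*} [Fintype κ] [DecidableEq κ] (ρ : Representation ℂ G V)
  (b : Module.Basis κ ℂ V)

theorem det_blockRep (g : G) : (blockRep ρ b g).det = 1 := by
  have hdet := GeneralLinearGroup.det_ne_zero (g : GL (Fin n) ℂ)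
  have hρ : LinearMap.det (ρ g) * LinearMap.det (ρ g⁻¹) = 1 := by
    rw [← map_mul, ← map_mul, mul_inv_cancel, map_one, map_one]
  rw [blockRep, MonoidHom.coe_mk, OneHom.coe_mk, det_fromBlocks_zero₂₁, det_fromBlocks_zero₂₁,
    det_unique (n := Unit), LinearMap.det_toMatrix, scalar_apply, diagonal_apply_eq,
    mul_left_comm (LinearMap.det (ρ g)), mul_inv_cancel_left₀ hdet, hρ]

variable {ρ} in
theorem blockRep_mem_regularFunctions [FiniteDimensional ℂ V] (hρ : IsRational ρ)
    (i j : Fin n ⊕ (κ ⊕ Unit)) : (fun g => blockRep ρ b g i j) ∈ regularFunctions G := by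
  have zero_mem : (fun _ : G => (0 : ℂ)) ∈ regularFunctions G := zero_mem _
  rcases i with i | i | _ <;> rcases j with j | j | _ <;> try exact zero_mem
  · exact entry_mem_regularFunctions i j
  · simpa only [blockRep, MonoidHom.coe_mk, OneHom.coe_mk, fromBlocks_apply₂₂, fromBlocks_apply₁₁,
      LinearMap.toMatrix_apply] using! hρ (b.coord i) (b j)
  · exact mul_mem inv_det_mem_regularFunctions
      (comp_inv_mem_regularFunctions (det_rep_mem_regularFunctions hρ))

theorem isZariskiClosed_range_blockRep [FiniteDimensional ℂ V]
    (hG : @IsClosed _ (zariski n) (G : Set (GL (Fin n) ℂ))) (hρ : IsRational ρ) :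
    IsZariskiClosed (Set.range (blockRep ρ b)) := by
  refine isZariskiClosed_range hG (blockRep_mem_regularFunctions b hρ) (e := Sum.inl)
    (q := rename (Prod.map Sum.inr Sum.inr) (mvPolynomialX (κ ⊕ Unit) (κ ⊕ Unit) ℂ).det)
    (fun g => rfl) fun g => ?_
  have h := det_blockRep ρ b g
  rw [← fromBlocks_toBlocks (blockRep ρ b g)] at h
  rw [evalMat_rename, evalMat_det, mul_comm]
  exact (det_fromBlocks_zero₂₁ _ _ _).symm.trans h

end BlockRep

/-- A realization of a rational representation inside a Zariski closed group of matrices of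
determinant one, isomorphic to `G`. -/
structure MatrixModel (ρ : Representation ℂ G V) (ι : Type*) [Fintype ι] [DecidableEq ι] where
  /-- the isomorphism onto a matrix group -/
  r : G →* Matrix ι ι ℂ
  regular : ∀ i j, (fun g => r g i j) ∈ regularFunctions G
  det_eq_one : ∀ g, (r g).det = 1
  closed : IsZariskiClosed (Set.range r)
  /-- the position of the standard representation -/
  idx : Fin n → ι
  submatrix_r : ∀ g, (r g).submatrix idx idx = (g : GL (Fin n) ℂ).1
  /-- the inclusion of `V` -/
  incl : V →ₗ[ℂ] (ι → ℂ)
  /-- a projection to `V` -/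
  proj : (ι → ℂ) →ₗ[ℂ] V
  proj_incl : ∀ x, proj (incl x) = x
  r_mulVec_incl : ∀ g x, r g *ᵥ incl x = incl (ρ g x)

/-- The matrix model given by `blockRep`. -/
def blockModel [FiniteDimensional ℂ V] (hG : @IsClosed _ (zariski n) (G : Set (GL (Fin n) ℂ)))
    {ρ : Representation ℂ G V} (hρ : IsRational ρ) {κ : Type*} [Fintype κ] [DecidableEq κ]
    (b : Module.Basis κ ℂ V) : MatrixModel ρ (Fin n ⊕ (κ ⊕ Unit)) where
  r := blockRep ρ b
  regular := blockRep_mem_regularFunctions b hρ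
  det_eq_one := det_blockRep ρ b
  closed := isZariskiClosed_range_blockRep ρ b hG hρ
  idx := Sum.inl
  submatrix_r _ := rfl
  incl :=
    { toFun := fun x => Sum.elim 0 (Sum.elim (b.equivFun x) 0)
      map_add' := fun x y => by ext (i | i | i) <;> simp
      map_smul' := fun c x => by ext (i | i | i) <;> simp }
  proj := b.equivFun.symm.toLinearMap ∘ₗ LinearMap.funLeft ℂ ℂ (Sum.inr ∘ Sum.inl)
  proj_incl x := b.equivFun.symm_apply_apply x
  r_mulVec_incl g x := by
    ext (i | i | i) <;>
      simp [blockRep, fromBlocks_mulVec, ← LinearMap.toMatrix_mulVec_repr b b (ρ g)]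

end Model

section OneParameterGroup

theorem eq_exp_smul_of_hasDerivAt {𝕜 𝔸 : Type*} [RCLike 𝕜] [NormedRing 𝔸] [NormedAlgebra 𝕜 𝔸]
    [NormedAlgebra ℚ 𝔸] [CompleteSpace 𝔸] {φ : 𝕜 → 𝔸} {A : 𝔸} (h0 : φ 0 = 1)
    (hadd : ∀ s t, φ (s + t) = φ s * φ t) (hφ : HasDerivAt φ A 0) (t : 𝕜) :
    φ t = NormedSpace.exp (t • A) := by
  have hφ' (t : 𝕜) : HasDerivAt φ (φ t * A) t := by
    have h : HasDerivAt (fun s => φ (t + s)) (φ t * A) (t - t) := by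
      simpa only [hadd, sub_self] using hφ.const_mul (φ t)
    simpa using h.comp_sub_const t t
  have hderiv (t : 𝕜) : HasDerivAt (fun t => φ t * NormedSpace.exp (t • -A)) 0 t := by
    simpa [mul_assoc] using! (hφ' t).mul (hasDerivAt_exp_smul_const' (-A) t)
  have hconst : φ t * NormedSpace.exp (t • -A) = 1 := by
    simpa [h0] using is_const_of_deriv_eq_zero (fun t => (hderiv t).differentiableAt)
      (fun t => (hderiv t).deriv) t 0
  have hinv : NormedSpace.exp (t • -A) * NormedSpace.exp (t • A) = 1 := by
    rw [smul_neg, ← NormedSpace.exp_add_of_commute (Commute.refl _).neg_left, neg_add_cancel,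
      NormedSpace.exp_zero]
  rw [← mul_one (φ t), ← hinv, ← mul_assoc, hconst, one_mul]

theorem hasDerivAt_linearMap_comp {ι κ 𝕜 F : Type*} [Finite ι] [Finite κ]
    [NontriviallyNormedField 𝕜] [NormedAddCommGroup F] [NormedSpace 𝕜 F]
    {φ : 𝕜 → Matrix ι κ 𝕜} {A : Matrix ι κ 𝕜} {t₀ : 𝕜}
    (hφ : ∀ i j, HasDerivAt (fun t => φ t i j) (A i j) t₀) (L : Matrix ι κ 𝕜 →ₗ[𝕜] F) :
    HasDerivAt (fun t => L (φ t)) (L A) t₀ := by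
  classical
  have := Fintype.ofFinite ι
  have := Fintype.ofFinite κ
  have hL (B : Matrix ι κ 𝕜) : L B = ∑ i, ∑ j, B i j • L (single i j 1) := by
    conv_lhs => rw [matrix_eq_sum_single B]
    simp only [map_sum, ← map_smul, smul_single, smul_eq_mul, mul_one]
  rw [hL A, funext fun t => hL (φ t)]
  exact HasDerivAt.fun_sum fun i _ => HasDerivAt.fun_sum fun j _ => (hφ i j).smul_const _

variable {ι : Type*} [Fintype ι] [DecidableEq ι]

theorem eq_exp_smul_of_hasDerivAt_apply {φ : ℂ → Matrix ι ι ℂ} {A : Matrix ι ι ℂ} (h0 : φ 0 = 1)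
    (hadd : ∀ s t, φ (s + t) = φ s * φ t)
    (hφ : ∀ i j, HasDerivAt (fun t => φ t i j) (A i j) 0) (t : ℂ) :
    φ t = NormedSpace.exp (t • A) := by
  open scoped Matrix.Norms.Operator in
  exact eq_exp_smul_of_hasDerivAt h0 hadd (hasDerivAt_linearMap_comp hφ LinearMap.id) t

theorem exp_add_smul (A : Matrix ι ι ℂ) (s t : ℂ) :
    NormedSpace.exp ((s + t) • A) = NormedSpace.exp (s • A) * NormedSpace.exp (t • A) := by
  rw [add_smul, Matrix.exp_add_of_commute _ _ (((Commute.refl A).smul_left s).smul_right t)]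

theorem hasDerivAt_exp_smul_zero_apply (A : Matrix ι ι ℂ) (i j : ι) :
    HasDerivAt (fun t : ℂ => (NormedSpace.exp (t • A) : Matrix ι ι ℂ) i j) (A i j) 0 := by
  simpa using hasDerivAt_exp_smul_apply A 0 i j

theorem differentiableAt_mvPolynomial_eval {𝕜 E σ : Type*} [NontriviallyNormedField 𝕜]
    [NormedAddCommGroup E] [NormedSpace 𝕜 E] {a : σ → E → 𝕜} {x : E}
    (ha : ∀ i, DifferentiableAt 𝕜 (a i) x) (p : MvPolynomial σ 𝕜) :
    DifferentiableAt 𝕜 (fun x => MvPolynomial.eval (fun i => a i x) p) x := by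
  induction p using MvPolynomial.induction_on with
  | C c => simp only [MvPolynomial.eval_C, differentiableAt_const]
  | add p q hp hq =>
    simp only [map_add]
    exact hp.add hq
  | mul_X p i hp =>
    simp only [map_mul, MvPolynomial.eval_X]
    exact hp.mul (ha i)

theorem differentiableAt_regularFunction {n : ℕ} {G : Subgroup (GL (Fin n) ℂ)} {f : G → ℂ}
    (hf : f ∈ regularFunctions G) {γ : ℂ → G} {t : ℂ}
    (hγ : ∀ i j, DifferentiableAt ℂ (fun t => (γ t : GL (Fin n) ℂ).1 i j) t) :
    DifferentiableAt ℂ (fun t => f (γ t)) t := by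
  obtain ⟨p, k, h⟩ := hf
  have heval := differentiableAt_mvPolynomial_eval fun ij : Fin n × Fin n => hγ ij.1 ij.2
  have hdet := heval (mvPolynomialX (Fin n) (Fin n) ℂ).det
  simp only [eval_det_mvPolynomialX] at hdet
  simp only [h]
  exact (heval p).div (hdet.pow k) (pow_ne_zero _ (GeneralLinearGroup.det_ne_zero _))

end OneParameterGroup

namespace MatrixModel

variable {n : ℕ} {G : Subgroup (GL (Fin n) ℂ)} {V : Type*} [AddCommGroup V] [Module ℂ V]
  {ρ : Representation ℂ G V} {ι : Type*} [Fintype ι] [DecidableEq ι] (M : MatrixModel ρ ι)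

/-- The endomorphism of `V` induced by a matrix. -/
def compress : Matrix ι ι ℂ →ₗ[ℂ] Module.End ℂ V where
  toFun A := M.proj ∘ₗ A.mulVecLin ∘ₗ M.incl
  map_add' A B := by
    ext x
    simp
  map_smul' c A := by
    ext x
    simp

theorem incl_injective : Function.Injective M.incl :=
  Function.LeftInverse.injective M.proj_incl

theorem r_injective : Function.Injective M.r := fun g h hgh =>
  Subtype.ext (Units.ext (by rw [← M.submatrix_r, hgh, M.submatrix_r]))

theorem compress_r (g : G) : M.compress (M.r g) = ρ g := by
  ext x
  exact (congrArg M.proj (M.r_mulVec_incl g x)).trans (M.proj_incl _)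

theorem mem_matLie_iff_exp (hG : IsReductive G) (A : Matrix ι ι ℂ) :
    A ∈ matLie M.r ↔ ∀ t : ℂ, NormedSpace.exp (t • A) ∈ Set.range M.r :=
  PolarRep.mem_matLie_iff_exp hG M.regular M.det_eq_one M.closed A

theorem mulVec_incl (hG : IsReductive G) {A : Matrix ι ι ℂ} (hA : A ∈ matLie M.r) (x : V) :
    A *ᵥ M.incl x = M.incl (M.compress A x) := by
  choose γ hγ using (M.mem_matLie_iff_exp hG A).1 hA
  let D : Matrix ι ι ℂ →ₗ[ℂ] ι → ℂ :=
    (mulVecBilin ℂ ℂ).flip (M.incl x) - M.incl ∘ₗ LinearMap.applyₗ x ∘ₗ M.compress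
  have hD (t : ℂ) : D (NormedSpace.exp (t • A)) = 0 := by
    rw [← hγ]
    exact sub_eq_zero.2 ((M.r_mulVec_incl _ x).trans (by rw [← M.compress_r]; rfl))
  have hderiv := hasDerivAt_linearMap_comp (hasDerivAt_exp_smul_zero_apply A) D
  simp only [hD] at hderiv
  exact sub_eq_zero.1 (hderiv.unique (hasDerivAt_const _ _))

/-- The Lie algebra of `G` acting on `V`. -/
def repLie : Submodule ℂ (Module.End ℂ V) := (matLie M.r).map M.compress

theorem lie_mem_repLie (hG : IsReductive G) {X Y : Module.End ℂ V} (hX : X ∈ M.repLie)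
    (hY : Y ∈ M.repLie) : ⁅X, Y⁆ ∈ M.repLie := by
  obtain ⟨A, hA, rfl⟩ := hX
  obtain ⟨B, hB, rfl⟩ := hY
  refine ⟨⁅A, B⁆, lie_mem_matLie hA hB, LinearMap.ext fun x => M.incl_injective ?_⟩
  rw [← M.mulVec_incl hG (lie_mem_matLie hA hB)]
  simp only [Ring.lie_def, LinearMap.sub_apply, map_sub, Module.End.mul_apply,
    ← M.mulVec_incl hG hA, ← M.mulVec_incl hG hB, sub_mulVec, mulVec_mulVec]

theorem conj_mem_repLie (hG : IsReductive G) (g : G) {X : Module.End ℂ V} (hX : X ∈ M.repLie) :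
    ρ g * X * ρ g⁻¹ ∈ M.repLie := by
  obtain ⟨A, hA, rfl⟩ := hX
  have hinv : M.r g⁻¹ * M.r g = 1 := by rw [← map_mul, inv_mul_cancel, map_one]
  have hB : M.r g * A * M.r g⁻¹ ∈ matLie M.r := fun f hf => by
    rw [← hf g, lieDer_rightTranslate (B := A) (by rw [mul_assoc, hinv, mul_one]), hA f hf,
      map_zero]
  refine ⟨_, hB, LinearMap.ext fun x => M.incl_injective ?_⟩
  rw [← M.mulVec_incl hG hB, Module.End.mul_apply, Module.End.mul_apply, ← M.r_mulVec_incl,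
    ← M.mulVec_incl hG hA, ← M.r_mulVec_incl, Matrix.mulVec_mulVec, Matrix.mulVec_mulVec, mul_assoc]

theorem exists_mem_matLie_eq_exp_smul (hG : IsReductive G) {X : Matrix (Fin n) (Fin n) ℂ}
    {γ : ℂ → G}
    (hγ : ∀ t : ℂ, ((γ t : GL (Fin n) ℂ) : Matrix (Fin n) (Fin n) ℂ) = NormedSpace.exp (t • X)) :
    ∃ A ∈ matLie M.r, ∀ t : ℂ, M.r (γ t) = NormedSpace.exp (t • A) := by
  have hadd (s t : ℂ) : γ (s + t) = γ s * γ t := Subtype.ext <| Units.ext <| by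
    rw [hγ, exp_add_smul, ← hγ, ← hγ]
    rfl
  have h0 : γ 0 = 1 := left_eq_mul.1 ((congrArg γ (add_zero 0).symm).trans (hadd 0 0))
  have hγd (i j : Fin n) : DifferentiableAt ℂ (fun t => (γ t : GL (Fin n) ℂ).1 i j) 0 := by
    simp only [hγ]
    exact (hasDerivAt_exp_smul_apply X 0 i j).differentiableAt
  have hexp := eq_exp_smul_of_hasDerivAt_apply (φ := fun t => M.r (γ t)) (by rw [h0, map_one])
    (fun s t => by rw [hadd, map_mul])
    fun i j => (differentiableAt_regularFunction (M.regular i j) hγd).hasDerivAt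
  exact ⟨_, (M.mem_matLie_iff_exp hG _).2 fun t => ⟨γ t, hexp t⟩, hexp⟩

theorem coe_eq_exp_smul_submatrix {A : Matrix ι ι ℂ} {γ : ℂ → G}
    (hγ : ∀ t, M.r (γ t) = NormedSpace.exp (t • A)) (t : ℂ) :
    (γ t : GL (Fin n) ℂ).1 = NormedSpace.exp (t • A.submatrix M.idx M.idx) := by
  have hadd (s t : ℂ) : γ (s + t) = γ s * γ t := M.r_injective <| by
    rw [map_mul, hγ, hγ, hγ, exp_add_smul]
  have h0 : γ 0 = 1 := left_eq_mul.1 ((congrArg γ (add_zero 0).symm).trans (hadd 0 0))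
  refine eq_exp_smul_of_hasDerivAt_apply (φ := fun t => (γ t : GL (Fin n) ℂ).1)
    (by rw [h0]; rfl) (fun s t => by rw [hadd]; rfl) (fun i j => ?_) t
  simp only [← M.submatrix_r, hγ]
  exact hasDerivAt_exp_smul_zero_apply A _ _

theorem hasDerivAt_dual_rep {A : Matrix ι ι ℂ} {γ : ℂ → G}
    (hγ : ∀ t, M.r (γ t) = NormedSpace.exp (t • A)) (l : Module.Dual ℂ V) (x : V) :
    HasDerivAt (fun t => l (ρ (γ t) x)) (l (M.compress A x)) 0 := by
  simp only [← M.compress_r, hγ]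
  exact hasDerivAt_linearMap_comp (hasDerivAt_exp_smul_zero_apply A)
    (l ∘ₗ LinearMap.applyₗ x ∘ₗ M.compress)

theorem lieOrbit_eq (hG : IsReductive G) (x : V) :
    lieOrbit ρ x = M.repLie.map (LinearMap.applyₗ x) := by
  refine le_antisymm (Submodule.span_le.2 ?_) ?_
  · rintro w ⟨X, γ, hγ, hw⟩
    obtain ⟨A, hA, hAγ⟩ := M.exists_mem_matLie_eq_exp_smul hG hγ
    refine ⟨_, ⟨A, hA, rfl⟩,
      sub_eq_zero.1 <| (Module.forall_dual_apply_eq_zero_iff ℂ _).1 fun l => ?_⟩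
    rw [map_sub, sub_eq_zero]
    exact (M.hasDerivAt_dual_rep hAγ l x).unique (hw l)
  · rintro _ ⟨_, ⟨A, hA, rfl⟩, rfl⟩
    choose γ hγ using (M.mem_matLie_iff_exp hG A).1 hA
    exact Submodule.subset_span ⟨_, γ, M.coe_eq_exp_smul_submatrix hγ,
      fun l => M.hasDerivAt_dual_rep hγ l x⟩

end MatrixModel

section InnerProduct

variable {V E : Type*} [AddCommGroup V] [Module ℂ V] [NormedAddCommGroup E] [InnerProductSpace ℂ E]

theorem det_eq_one_or_eq_neg_one_of_injective [FiniteDimensional ℂ V] {e : V →ₗ[ℂ] E}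
    (he : Function.Injective e) {𝔨 : Submodule ℂ (Module.End ℂ V)}
    (hbr : ∀ X ∈ 𝔨, ∀ Y ∈ 𝔨, ⁅X, Y⁆ ∈ 𝔨)
    (hadj : ∀ X ∈ 𝔨, ∃ Y ∈ 𝔨, ∀ x y, inner ℂ (e (X x)) (e y) = inner ℂ (e x) (e (Y y)))
    {v : V} (hv : ∀ X ∈ 𝔨, inner ℂ (e v) (e (X v)) = 0) {C : Submodule ℂ V} (hvC : v ∈ C)
    (hC : ∀ x ∈ C, ∀ X ∈ 𝔨, X x ∈ 𝔨.map (LinearMap.applyₗ v))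
    (hdim : Module.finrank ℂ C + Module.finrank ℂ (𝔨.map (LinearMap.applyₗ v)) =
      Module.finrank ℂ V)
    {h : V ≃ₗ[ℂ] V} (hh : ∀ X ∈ 𝔨, h.conj X ∈ 𝔨) (hfix : ∀ c ∈ C, h c = c) :
    LinearMap.det h.toLinearMap = 1 ∨ LinearMap.det h.toLinearMap = -1 := by
  let core : InnerProductSpace.Core ℂ V :=
    { inner x y := inner ℂ (e x) (e y)
      conj_inner_symm _ _ := inner_conj_symm _ _
      re_inner_nonneg _ := inner_self_nonneg
      add_left _ _ _ := by rw [map_add, inner_add_left]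
      smul_left _ _ _ := by rw [map_smul, inner_smul_left]
      definite _ hx := he ((inner_self_eq_zero.1 hx).trans (map_zero e).symm) }
  let : NormedAddCommGroup V := core.toNormedAddCommGroup
  let : InnerProductSpace ℂ V := InnerProductSpace.ofCore core.toCore
  refine det_eq_one_or_eq_neg_one_of_adjoint_mem hbr (fun X hX => ?_) hv hvC hC hdim hh hfix
  obtain ⟨Y, hY, hXY⟩ := hadj X hX
  have hX' : X = LinearMap.adjoint Y := (LinearMap.eq_adjoint_iff X Y).2 hXY
  rwa [hX', LinearMap.adjoint_adjoint]

theorem inner_toLp_mulVec {ι 𝕜 : Type*} [Fintype ι] [RCLike 𝕜] (B : Matrix ι ι 𝕜) (x y : ι → 𝕜) :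
    inner 𝕜 (WithLp.toLp 2 (B *ᵥ x)) (WithLp.toLp 2 y) =
      inner 𝕜 (WithLp.toLp 2 x) (WithLp.toLp 2 (Bᴴ *ᵥ y)) := by
  rw [EuclideanSpace.inner_toLp_toLp, EuclideanSpace.inner_toLp_toLp, star_mulVec, dotProduct_comm,
    ← dotProduct_mulVec, dotProduct_comm]

end InnerProduct

section MinimalVector

variable {n : ℕ} {G : Subgroup (GL (Fin n) ℂ)} {V E : Type*} [AddCommGroup V] [Module ℂ V]
  [NormedAddCommGroup E] [NormedSpace ℂ E] [FiniteDimensional ℂ E]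

theorem continuous_polynomialFunction_comp (L : E →ₗ[ℂ] V) {f : V → ℂ}
    (hf : f ∈ polynomialFunctions V) : Continuous fun y => f (L y) := by
  induction hf using Algebra.adjoin_induction with
  | mem f hf =>
    obtain ⟨l, rfl⟩ := hf
    exact (l ∘ₗ L).continuous_of_finiteDimensional
  | algebraMap c => exact continuous_const
  | add f g _ _ hf hg => exact hf.add hg
  | mul f g _ _ hf hg => exact hf.mul hg

theorem IsSemisimpleVector.isClosed_range_comp {ρ : Representation ℂ G V} {v : V}
    (hv : IsSemisimpleVector ρ v) {e : V →ₗ[ℂ] E} (he : Function.Injective e) :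
    IsClosed (Set.range fun g : G => e (ρ g v)) := by
  obtain ⟨S, hS, hSv⟩ := hv
  obtain ⟨L, hL⟩ := e.exists_leftInverse_of_injective (LinearMap.ker_eq_bot.2 he)
  have hLe (x : V) : L (e x) = x := LinearMap.congr_fun hL x
  have hrange : (Set.range fun g : G => e (ρ g v)) =
      {y | e (L y) = y} ∩ ⋂ f ∈ S, {y | f (L y) = 0} := by
    rw [show (Set.range fun g : G => e (ρ g v)) = e '' Set.range fun g : G => ρ g v from
      Set.range_comp e _, hSv]
    ext y
    simp only [Set.mem_image, Set.mem_inter_iff, Set.mem_iInter, Set.mem_ofPred_eq]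
    constructor
    · rintro ⟨x, hx, rfl⟩
      exact ⟨by rw [hLe], fun f hf => by rw [hLe, hx f hf]⟩
    · exact fun ⟨hy, hyS⟩ => ⟨L y, hyS, hy⟩
  rw [hrange]
  exact (isClosed_eq (e ∘ₗ L).continuous_of_finiteDimensional continuous_id).inter
    (isClosed_biInter fun f hf =>
      isClosed_eq (continuous_polynomialFunction_comp L (hS hf)) continuous_const)

theorem IsSemisimpleVector.exists_norm_le {ρ : Representation ℂ G V} {v : V}
    (hv : IsSemisimpleVector ρ v) {e : V →ₗ[ℂ] E} (he : Function.Injective e) :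
    ∃ g₀ : G, ∀ g : G, ‖e (ρ g₀ v)‖ ≤ ‖e (ρ g v)‖ := by
  have : ProperSpace E := FiniteDimensional.proper ℂ E
  obtain ⟨_, ⟨g₀, rfl⟩, hg₀⟩ :=
    (hv.isClosed_range_comp he).exists_infDist_eq_dist (Set.range_nonempty _) 0
  refine ⟨g₀, fun g => ?_⟩
  simpa only [hg₀, dist_zero_left] using
    Metric.infDist_le_dist_of_mem (x := (0 : E)) (Set.mem_range_self (f := fun g => e (ρ g v)) g)

end MinimalVector

namespace MatrixModel

variable {n : ℕ} {G : Subgroup (GL (Fin n) ℂ)} {V : Type*} [AddCommGroup V] [Module ℂ V]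
  {ρ : Representation ℂ G V} {ι : Type*} [Fintype ι] [DecidableEq ι] (M : MatrixModel ρ ι)

/-- The embedding of `V` in Hermitian space obtained by applying the matrix `m` to the model; it
carries to `V` the inner product for which `V ⊆ ℂ^ι` is twisted by `m`. -/
def euclid (m : Matrix ι ι ℂ) : V →ₗ[ℂ] EuclideanSpace ℂ ι :=
  (WithLp.linearEquiv 2 ℂ (ι → ℂ)).symm.toLinearMap ∘ₗ m.mulVecLin ∘ₗ M.incl

theorem euclid_apply (m : Matrix ι ι ℂ) (x : V) :
    M.euclid m x = WithLp.toLp 2 (m *ᵥ M.incl x) :=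
  rfl

theorem euclid_injective {m : Matrix ι ι ℂ} (hm : IsUnit m) : Function.Injective (M.euclid m) :=
  (WithLp.toLp_injective 2).comp ((mulVec_injective_iff_isUnit.2 hm).comp M.incl_injective)

theorem re_inner_euclid_eq_zero (hG : IsReductive G) (m : Matrix ι ι ℂ) {x : V}
    (hx : ∀ g : G, ‖M.euclid m x‖ ≤ ‖M.euclid m (ρ g x)‖) {X : Module.End ℂ V}
    (hX : X ∈ M.repLie) : (inner ℂ (M.euclid m x) (M.euclid m (X x))).re = 0 := by
  obtain ⟨A, hA, rfl⟩ := hX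
  choose γ hγ using (M.mem_matLie_iff_exp hG A).1 hA
  have hexp (t : ℂ) : M.compress (NormedSpace.exp (t • A)) = ρ (γ t) := by
    rw [← hγ, M.compress_r]
  have hγ0 : ρ (γ 0) = 1 := by
    rw [← M.compress_r, hγ, zero_smul, NormedSpace.exp_zero, ← map_one M.r, M.compress_r, map_one]
  have horbit := hasDerivAt_linearMap_comp (hasDerivAt_exp_smul_zero_apply A)
    (M.euclid m ∘ₗ LinearMap.applyₗ x ∘ₗ M.compress)
  simp only [LinearMap.comp_apply, LinearMap.applyₗ_apply_apply, hexp] at horbit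
  have hnorm := (HasDerivAt.scomp_of_eq (0 : ℝ) horbit Complex.ofRealCLM.hasDerivAt
    Complex.ofReal_zero.symm).norm_sq
  have hmin : IsLocalMin (fun t : ℝ => ‖M.euclid m (ρ (γ t) x)‖ ^ 2) 0 :=
    Filter.Eventually.of_forall fun t => by
      simpa [hγ0] using pow_le_pow_left₀ (norm_nonneg _) (hx (γ t)) 2
  have hzero : inner ℝ (M.euclid m x) (M.euclid m (M.compress A x)) = 0 := by
    simpa [hγ0] using hmin.hasDerivAt_eq_zero hnorm
  simpa only [PiLp.inner_apply, Complex.re_sum] using! hzero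

theorem inner_euclid_eq_zero (hG : IsReductive G) (m : Matrix ι ι ℂ) {x : V}
    (hx : ∀ g : G, ‖M.euclid m x‖ ≤ ‖M.euclid m (ρ g x)‖) {X : Module.End ℂ V}
    (hX : X ∈ M.repLie) : inner ℂ (M.euclid m x) (M.euclid m (X x)) = 0 := by
  refine Complex.ext (M.re_inner_euclid_eq_zero hG m hx hX) ?_
  have hI := M.re_inner_euclid_eq_zero hG m hx (M.repLie.smul_mem Complex.I hX)
  rw [LinearMap.smul_apply, map_smul, inner_smul_right, Complex.I_mul_re, neg_eq_zero] at hI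
  exact hI

theorem exists_mem_repLie_inner_euclid (hG : IsReductive G) {m : Matrix ι ι ℂ} (hm : IsUnit m)
    (hadj : ∀ A ∈ matLie M.r, m⁻¹ * (m * A * m⁻¹)ᴴ * m ∈ matLie M.r) {X : Module.End ℂ V}
    (hX : X ∈ M.repLie) : ∃ Y ∈ M.repLie, ∀ x y,
      inner ℂ (M.euclid m (X x)) (M.euclid m y) = inner ℂ (M.euclid m x) (M.euclid m (Y y)) := by
  obtain ⟨A, hA, rfl⟩ := hX
  have hdet := (isUnit_iff_isUnit_det m).1 hm
  refine ⟨_, ⟨_, hadj A hA, rfl⟩, fun x y => ?_⟩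
  have hleft : M.euclid m (M.compress A x) = WithLp.toLp 2 ((m * A * m⁻¹) *ᵥ m *ᵥ M.incl x) := by
    rw [euclid_apply, ← M.mulVec_incl hG hA, mulVec_mulVec, mulVec_mulVec,
      nonsing_inv_mul_cancel_right _ _ hdet]
  have hright : M.euclid m (M.compress (m⁻¹ * (m * A * m⁻¹)ᴴ * m) y) =
      WithLp.toLp 2 ((m * A * m⁻¹)ᴴ *ᵥ m *ᵥ M.incl y) := by
    rw [euclid_apply, ← M.mulVec_incl hG (hadj A hA), mulVec_mulVec, mulVec_mulVec, mul_assoc m⁻¹,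
      mul_nonsing_inv_cancel_left _ _ hdet]
  rw [hleft, hright, euclid_apply, euclid_apply, inner_toLp_mulVec]

end MatrixModel

section Determinant

variable {n : ℕ} {G : Subgroup (GL (Fin n) ℂ)} {V : Type*} [AddCommGroup V] [Module ℂ V]
  {ρ : Representation ℂ G V} {C : Submodule ℂ V}

theorem iSup_lieOrbit_eq {v : V} (hCv : ∀ x, x ∈ C ↔ lieOrbit ρ x ≤ lieOrbit ρ v) :
    ⨆ c ∈ C, lieOrbit ρ c = lieOrbit ρ v :=
  le_antisymm (iSup₂_le fun _ hc => (hCv _).1 hc)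
    (le_iSup₂_of_le v ((hCv v).2 le_rfl) le_rfl)

theorem det_eq_one_or_eq_neg_one_of_fix [FiniteDimensional ℂ V]
    (hclosed : @IsClosed _ (zariski n) (G : Set (GL (Fin n) ℂ))) (hG : IsReductive G)
    (hρ : IsRational ρ) {v : V} (hv : IsSemisimpleVector ρ v)
    (hCv : ∀ x, x ∈ C ↔ lieOrbit ρ x ≤ lieOrbit ρ v) (hstable : IsStable ρ C) {g : G}
    (hg : ∀ c ∈ C, ρ g c = c) : LinearMap.det (ρ g) = 1 ∨ LinearMap.det (ρ g) = -1 := by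
  let M := blockModel hclosed hρ (Module.finBasis ℂ V)
  obtain ⟨m, hm, hmadj⟩ := exists_conjTranspose_mem_matLie hG M.regular M.det_eq_one
  have hunit : IsUnit m := (isUnit_iff_isUnit_det m).2 (hm ▸ isUnit_one)
  obtain ⟨g₀, hg₀⟩ := hv.exists_norm_le (M.euclid_injective hunit)
  let h : V ≃ₗ[ℂ] V := LinearEquiv.ofLinearMap (ρ g) (ρ g⁻¹)
    (LinearMap.ext (ρ.self_inv_apply g)) (LinearMap.ext (ρ.inv_self_apply g))
  rw [IsStable, iSup_lieOrbit_eq hCv, M.lieOrbit_eq hG] at hstable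
  refine det_eq_one_or_eq_neg_one_of_injective (e := M.euclid m ∘ₗ ρ g₀) (h := h)
    ((M.euclid_injective hunit).comp (Function.LeftInverse.injective (ρ.inv_self_apply g₀)))
    (fun X hX Y hY => M.lie_mem_repLie hG hX hY) (fun X hX => ?_) (fun X hX => ?_)
    ((hCv v).2 le_rfl) (fun x hx X hX => ?_) hstable
    (fun X hX => M.conj_mem_repLie hG g hX) hg
  · obtain ⟨Y, hY, hXY⟩ :=
      M.exists_mem_repLie_inner_euclid hG hunit hmadj (M.conj_mem_repLie hG g₀ hX)
    refine ⟨ρ g₀⁻¹ * Y * ρ g₀, by simpa only [inv_inv] using M.conj_mem_repLie hG g₀⁻¹ hY,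
      fun x y => ?_⟩
    simpa only [LinearMap.comp_apply, Module.End.mul_apply, ρ.inv_self_apply,
      ρ.self_inv_apply] using hXY (ρ g₀ x) (ρ g₀ y)
  · have hmin (g : G) : ‖M.euclid m (ρ g₀ v)‖ ≤ ‖M.euclid m (ρ g (ρ g₀ v))‖ := by
      rw [← Module.End.mul_apply, ← map_mul]
      exact hg₀ _
    simpa only [LinearMap.comp_apply, Module.End.mul_apply, ρ.inv_self_apply] using
      M.inner_euclid_eq_zero hG m hmin (M.conj_mem_repLie hG g₀ hX)
  · have hx := (hCv x).1 hx
    rw [M.lieOrbit_eq hG, M.lieOrbit_eq hG] at hx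
    exact hx ⟨X, hX, rfl⟩

theorem exists_isOpen_zariski_ne {f : G → ℂ} (hf : f ∈ regularFunctions G) (c : ℂ) :
    ∃ U, @IsOpen _ (zariski n) U ∧ ∀ g : G, (g : GL (Fin n) ℂ) ∈ U ↔ f g ≠ c := by
  let := zariski n
  obtain ⟨p, k, hp⟩ := hf
  let q := p - MvPolynomial.C c * (mvPolynomialX (Fin n) (Fin n) ℂ).det ^ k
  refine ⟨{g | MvPolynomial.eval (fun ij => g.1 ij.1 ij.2) q ≠ 0},
    TopologicalSpace.isOpen_generateFrom_of_mem ⟨q, rfl⟩, fun g => not_congr ?_⟩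
  rw [hp, div_eq_iff (pow_ne_zero _ (GeneralLinearGroup.det_ne_zero _)), map_sub, map_mul, map_pow,
    eval_det_mvPolynomialX, MvPolynomial.eval_C, sub_eq_zero]
  rfl

theorem eq_of_isPreconnected_zariski {f : G → ℂ} (hf : f ∈ regularFunctions G)
    {S : Set (GL (Fin n) ℂ)} (hS : @IsPreconnected _ (zariski n) S) (hSG : S ⊆ G) {a b : ℂ}
    (hab : ∀ g : G, (g : GL (Fin n) ℂ) ∈ S → f g = a ∨ f g = b) {g h : G}
    (hg : (g : GL (Fin n) ℂ) ∈ S) (hh : (h : GL (Fin n) ℂ) ∈ S) : f g = f h := by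
  by_contra hne
  obtain ⟨U, hU, hUf⟩ := exists_isOpen_zariski_ne hf (f g)
  obtain ⟨W, hW, hWf⟩ := exists_isOpen_zariski_ne hf (f h)
  obtain ⟨x, hxS, hxU, hxW⟩ := hS U W hU hW
    (fun x hx => by
      by_cases hxg : f ⟨x, hSG hx⟩ = f g
      · exact .inr ((hWf ⟨x, hSG hx⟩).2 (hxg ▸ hne))
      · exact .inl ((hUf ⟨x, hSG hx⟩).2 hxg))
    ⟨h, hh, (hUf h).2 (Ne.symm hne)⟩ ⟨g, hg, (hWf g).2 hne⟩
  have hxg := (hUf ⟨x, hSG hxS⟩).1 hxU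
  have hxh := (hWf ⟨x, hSG hxS⟩).1 hxW
  grind [hab g hg, hab h hh, hab ⟨x, hSG hxS⟩ hxS]

theorem mem_centralizer_iff {g : G} :
    (g : GL (Fin n) ℂ) ∈ centralizer ρ C ↔ ∀ c ∈ C, ρ g c = c :=
  Subgroup.mem_map_iff_mem G.subtype_injective

theorem centralizer_le : centralizer ρ C ≤ G :=
  Subgroup.map_subtype_le _

theorem existsUnique_quotient_intUnits_hom {H R : Type*} [Group H] [Ring R] [CharZero R]
    (N : Subgroup H) [N.Normal] {χ : H →* R} (hχ : ∀ h, χ h = 1 ∨ χ h = -1)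
    (hN : ∀ h ∈ N, χ h = 1) : ∃! τ : H ⧸ N →* ℤˣ, ∀ h : H, (((τ h : ℤˣ) : ℤ) : R) = χ h := by
  have hinj : Function.Injective fun a : ℤˣ => ((a : ℤ) : R) :=
    Int.cast_injective.comp Units.val_injective
  have hsign (h : H) : ∃ u : ℤˣ, ((u : ℤ) : R) = χ h := by
    rcases hχ h with hh | hh
    · exact ⟨1, by rw [hh, Units.val_one, Int.cast_one]⟩
    · exact ⟨-1, by rw [hh, Units.val_neg, Units.val_one, Int.cast_neg, Int.cast_one]⟩
  choose u hu using hsign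
  let χ' : H →* ℤˣ := MonoidHom.mk' u fun a b => hinj (by
    simp only [Units.val_mul, Int.cast_mul, hu, map_mul])
  have hker : N ≤ χ'.ker := fun h hh => hinj (by
    simp only [χ', MonoidHom.mk'_apply, hu, hN h hh, Units.val_one, Int.cast_one])
  refine ⟨QuotientGroup.lift N χ' hker, hu, fun τ hτ => QuotientGroup.monoidHom_ext _ ?_⟩
  exact MonoidHom.ext fun h => hinj ((hτ h).trans (hu h).symm)

end Determinant

end PolarRep

end

theorem mainTheorem12_general {n : ℕ} {G : Subgroup (GL (Fin n) ℂ)}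
    (hclosed : @IsClosed _ (PolarRep.zariski n) (G : Set (GL (Fin n) ℂ)))
    (hG : PolarRep.IsReductive G)
    {V : Type*} [AddCommGroup V] [Module ℂ V] [FiniteDimensional ℂ V]
    {ρ : Representation ℂ G V} (hρ : PolarRep.IsRational ρ)
    {C : Submodule ℂ V} {v : V} (hv : PolarRep.IsSemisimpleVector ρ v)
    (hCv : (C : Set V) = {x | PolarRep.lieOrbit ρ x ≤ PolarRep.lieOrbit ρ v})
    (hstable : PolarRep.IsStable ρ C) :
    (∀ g : G, (∀ c ∈ C, ρ g c = c) → LinearMap.det (ρ g) = 1 ∨ LinearMap.det (ρ g) = -1) ∧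
    ∃! τ : PolarRep.inertia ρ C →* ℤˣ,
      ∀ (g : G) (hg : (g : GL (Fin n) ℂ) ∈ PolarRep.centralizer ρ C),
        (((τ (QuotientGroup.mk ⟨g, hg⟩) : ℤˣ) : ℤ) : ℂ) = LinearMap.det (ρ g) := by
  have hdet (g : G) (hg : ∀ c ∈ C, ρ g c = c) :=
    PolarRep.det_eq_one_or_eq_neg_one_of_fix hclosed hG hρ hv (Set.ext_iff.1 hCv) hstable hg
  refine ⟨hdet, ?_⟩
  let χ : PolarRep.centralizer ρ C →* ℂ :=
    LinearMap.det.comp (ρ.comp (Subgroup.inclusion PolarRep.centralizer_le))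
  have hχ (h : PolarRep.centralizer ρ C) : χ h = 1 ∨ χ h = -1 :=
    hdet _ (PolarRep.mem_centralizer_iff.1 h.2)
  have hχ0 : ∀ h ∈ PolarRep.identityComponent (PolarRep.centralizer ρ C), χ h = 1 := by
    let := PolarRep.zariski n
    intro h hh
    have hsub := connectedComponentIn_subset (PolarRep.centralizer ρ C : Set (GL (Fin n) ℂ)) 1
    have hone := mem_connectedComponentIn (PolarRep.centralizer ρ C).one_mem
    rw [← map_one χ]
    exact PolarRep.eq_of_isPreconnected_zariski (PolarRep.det_rep_mem_regularFunctions hρ)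
      isPreconnected_connectedComponentIn (hsub.trans PolarRep.centralizer_le)
      (fun g hg => hdet g (PolarRep.mem_centralizer_iff.1 (hsub hg))) hh hone
  obtain ⟨τ, hτ, huniq⟩ := PolarRep.existsUnique_quotient_intUnits_hom _ hχ hχ0
  exact ⟨τ, fun g hg => hτ ⟨g, hg⟩, fun τ' hτ' => huniq τ' fun h =>
    hτ' (Subgroup.inclusion PolarRep.centralizer_le h) h.2⟩

theorem mainTheorem12 {n : ℕ} (G : Subgroup (GL (Fin n) ℂ))
    (hG : PolarRep.IsConnectedReductiveGroup G)
    {V : Type*} [AddCommGroup V] [Module ℂ V] [FiniteDimensional ℂ V]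
    (ρ : Representation ℂ G V) (hρ : PolarRep.IsRational ρ)
    (C : Submodule ℂ V) (hC : PolarRep.IsCartanSubspace ρ C) (hstable : PolarRep.IsStable ρ C) :
    (∀ g : G, (∀ c ∈ C, ρ g c = c) → LinearMap.det (ρ g) = 1 ∨ LinearMap.det (ρ g) = -1) ∧
    ∃! τ : PolarRep.inertia ρ C →* ℤˣ,
      ∀ (g : G) (hg : (g : GL (Fin n) ℂ) ∈ PolarRep.centralizer ρ C),
        (((τ (QuotientGroup.mk ⟨g, hg⟩) : ℤˣ) : ℤ) : ℂ) = LinearMap.det (ρ g) := by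
  obtain ⟨v, hv, hCv, -⟩ := hC
  exact mainTheorem12_general hG.isClosed hG.isReductive hρ hv hCv hstable
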